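/- Let $k$ be an arbitrary field, let $M=N=\mathbb Z^d$ be dual lattices paired by $(\cdot,\cdot)$, and let $\sigma\subset N_{\mathbb R}=\mathbb R^d$ be a strongly convex, rational polyhedral, $d$-dimensional cone with dual cone $\sigma^\vee\subset M_{\mathbb R}$. Let $X=\operatorname{Spec}k[\sigma^\vee\cap M]$ be the associated affine toric variety. For a positive integer $l$ put $X_{(l)}=\operatorname{Spec}k[\sigma^\vee\cap\tfrac1lM]$ and let $F^{(l)}:X_{(l)}\to X$ be the morphism induced by the inclusion $M\subset\tfrac1lM$. The $(l)$-th F-blowup $\mathrm{FB}_{(l)}(X)\to X$ is the universal birational flattening of $F^{(l)}$: it is universal among proper birational morphisms $Y\to X$ from a variety $Y$ such that $(Y\times_XX_{(l)})_{\mathrm{red}}$ is flat over $Y$. The limit F-blowup $\mathrm{FB}_{(\infty)}(X)$ is $\mathrm{FB}_{(l)}(X)$ for all sufficiently large $l$, and $\widetilde{\mathrm{FB}}_{(\infty)}(X)$ is its normalization. The latter is a normal toric variety, proper and birational over $X$; let $\Delta$ be its fan, a subdivision of $\sigma$. Let $w\in\sigma\cap N$ be primitive, and let $\Lambda_{(=1)}=\sigma^\vee\cap\{a\in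 M_{\mathbb R}:(a,w)=1\}$. There exists $a\in M$ in the interior of $\sigma^\vee$ with $(a,w)=1$ if and only if the relative interior of $\Lambda_{(=1)}$ contains a point of $M$. If this holds, then the ray $\mathbb R_{\ge0}w$ is a cone of the fan $\Delta$. Moreover, the toric divisor over $X$ attached to $w$ (the torus-invariant prime divisor of $\operatorname{Spec}k[(\mathbb R_{\ge0}w)^\vee\cap M]$) then appears on $\widetilde{\mathrm{FB}}_{(\infty)}(X)$ as a prime divisor: under the natural birational map over $X$, it corresponds to a prime divisor of $\widetilde{\mathrm{FB}}_{(\infty)}(X)$. Precisely: there is $l_0$ depending only on $X$ such that, for every $l\ge l_0$ and every $w$ as above, both conclusions hold for the normalization of $\mathrm{FB}_{(l)}(X)$ and its fan. -/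

import Mathlib

open CategoryTheory CategoryTheory.Limits AlgebraicGeometry

universe u

noncomputable section

namespace FBlowup

/-! ### Lattices and cones

The lattices are `N = M = ℤ^d`, paired by the standard pairing, and `N_ℝ = M_ℝ = ℝ^d`. -/

/-- The inclusion of the lattice `ℤ^d` into `ℝ^d`. -/
def latticeVec {d : ℕ} (m : Fin d → ℤ) : Fin d → ℝ := fun i => (m i : ℝ)

/-- A primitive lattice vector: nonzero and not divisible by any integer `n ≥ 2`. -/
def IsPrimitive {d : ℕ} (w : Fin d → ℤ) : Prop :=
  w ≠ 0 ∧ ∀ n : ℕ, 2 ≤ n → ∀ v : Fin d → ℤ, w ≠ n • v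

/-- The dual cone `τ^∨ = {a | (a, v) ≥ 0 for all v ∈ τ}`. -/
def dualCone {d : ℕ} (τ : PointedCone ℝ (Fin d → ℝ)) : PointedCone ℝ (Fin d → ℝ) where
  carrier := {a | ∀ v ∈ τ, 0 ≤ a ⬝ᵥ v}
  zero_mem' := by intro v _; simp
  add_mem' := by
    intro a b ha hb v hv
    rw [add_dotProduct]
    exact add_nonneg (ha v hv) (hb v hv)
  smul_mem' := by
    intro c a ha v hv
    have h : (c • a) ⬝ᵥ v = (c : ℝ) * (a ⬝ᵥ v) := smul_dotProduct (c : ℝ) a v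
    rw [h]
    exact mul_nonneg c.2 (ha v hv)

/-- A rational polyhedral cone: generated by finitely many lattice vectors. -/
def IsRationalPolyhedral {d : ℕ} (τ : PointedCone ℝ (Fin d → ℝ)) : Prop :=
  ∃ s : Finset (Fin d → ℤ), τ = PointedCone.hull ℝ (latticeVec '' (s : Set (Fin d → ℤ)))

/-- The ray `ℝ_{≥0} w`. -/
def ray {d : ℕ} (w : Fin d → ℤ) : PointedCone ℝ (Fin d → ℝ) :=
  PointedCone.hull ℝ {latticeVec w}

/-- The level polyhedron `Λ_{(=c)} = σ^∨ ∩ {w = c}`. -/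
def levelPolyhedron {d : ℕ} (σ : PointedCone ℝ (Fin d → ℝ)) (w : Fin d → ℤ) (c : ℝ) :
    Set (Fin d → ℝ) :=
  {a | a ∈ dualCone σ ∧ a ⬝ᵥ latticeVec w = c}

/-- A fan in `ℝ^d`: a finite collection of strongly convex rational polyhedral cones, closed under
taking faces, any two of which meet along a common face. -/
structure Fan (d : ℕ) where
  cones : Set (PointedCone ℝ (Fin d → ℝ))
  finite : cones.Finite
  rational : ∀ τ ∈ cones, IsRationalPolyhedral τ
  salient : ∀ τ ∈ cones, (τ : ConvexCone ℝ (Fin d → ℝ)).Salient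
  face_mem : ∀ τ ∈ cones, ∀ τ' : PointedCone ℝ (Fin d → ℝ), τ'.IsFaceOf τ → τ' ∈ cones
  inf_isFaceOf : ∀ τ ∈ cones, ∀ τ' ∈ cones, (τ ⊓ τ').IsFaceOf τ

theorem Fan.inf_mem {d : ℕ} (Δ : Fan d) {τ τ' : PointedCone ℝ (Fin d → ℝ)}
    (h : τ ∈ Δ.cones) (h' : τ' ∈ Δ.cones) : τ ⊓ τ' ∈ Δ.cones :=
  Δ.face_mem τ h _ (Δ.inf_isFaceOf τ h τ' h')

/-! ### Affine toric varieties -/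

/-- The monoid `τ^∨ ∩ (1/l)·M`. -/
def latticeMonoid {d : ℕ} (l : ℕ+) (τ : PointedCone ℝ (Fin d → ℝ)) :
    AddSubmonoid (Fin d → ℝ) where
  carrier := {x | x ∈ dualCone τ ∧ ∃ m : Fin d → ℤ, ((l : ℕ) : ℝ) • x = latticeVec m}
  zero_mem' := ⟨zero_mem _, 0, by funext i; simp [latticeVec]⟩
  add_mem' := by
    rintro x y ⟨hx, m, hm⟩ ⟨hy, n, hn⟩
    refine ⟨add_mem hx hy, m + n, ?_⟩
    rw [smul_add, hm, hn]
    funext i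
    simp [latticeVec]

theorem dualCone_anti {d : ℕ} {τ σ : PointedCone ℝ (Fin d → ℝ)} (h : τ ≤ σ) :
    dualCone σ ≤ dualCone τ :=
  fun _ ha v hv => ha v (h hv)

theorem latticeMonoid_anti {d : ℕ} (l : ℕ+) {τ σ : PointedCone ℝ (Fin d → ℝ)} (h : τ ≤ σ) :
    latticeMonoid l σ ≤ latticeMonoid l τ :=
  fun _ hx => ⟨dualCone_anti h hx.1, hx.2⟩

theorem latticeMonoid_one_le {d : ℕ} (l : ℕ+) (σ : PointedCone ℝ (Fin d → ℝ)) :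
    latticeMonoid 1 σ ≤ latticeMonoid l σ := by
  rintro x ⟨hx, m, hm⟩
  refine ⟨hx, (l : ℕ) • m, ?_⟩
  have hm' : x = latticeVec m := by simpa using hm
  rw [hm']
  funext i
  simp [latticeVec]

theorem ray_le {d : ℕ} {σ : PointedCone ℝ (Fin d → ℝ)} {w : Fin d → ℤ} (hw : latticeVec w ∈ σ) :
    ray w ≤ σ :=
  Submodule.span_le.mpr (Set.singleton_subset_iff.mpr hw)

/-- The affine scheme `Spec k[S]` of a monoid `S`. -/
def monoidScheme (k : Type u) [Field k] {d : ℕ} (S : AddSubmonoid (Fin d → ℝ)) : Scheme.{u} :=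
  Spec (CommRingCat.of (AddMonoidAlgebra k S))

/-- The morphism `Spec k[T] ⟶ Spec k[S]` induced by an inclusion `S ≤ T`. -/
def monoidSchemeMap (k : Type u) [Field k] {d : ℕ} {S T : AddSubmonoid (Fin d → ℝ)} (h : S ≤ T) :
    monoidScheme k T ⟶ monoidScheme k S :=
  Spec.map (CommRingCat.ofHom
    (AddMonoidAlgebra.mapDomainRingHom k (AddSubmonoid.inclusion h)))

/-- The affine toric variety `X_τ = Spec k[τ^∨ ∩ M]`. -/
abbrev toricVariety (k : Type u) [Field k] {d : ℕ} (τ : PointedCone ℝ (Fin d → ℝ)) :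
    Scheme.{u} :=
  monoidScheme k (latticeMonoid 1 τ)

/-- The toric morphism `X_τ ⟶ X_σ` for `τ ⊆ σ`. -/
abbrev toricMap (k : Type u) [Field k] {d : ℕ} {τ σ : PointedCone ℝ (Fin d → ℝ)} (h : τ ≤ σ) :
    toricVariety k τ ⟶ toricVariety k σ :=
  monoidSchemeMap k (latticeMonoid_anti 1 h)

/-- The Frobenius-like morphism `F^{(l)} : X_{(l)} = Spec k[σ^∨ ∩ (1/l)·M] ⟶ X = Spec k[σ^∨ ∩ M]`
induced by the inclusion of monoids. -/
abbrev frobeniusLike (k : Type u) [Field k] {d : ℕ} (l : ℕ+) (σ : PointedCone ℝ (Fin d → ℝ)) :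
    monoidScheme k (latticeMonoid l σ) ⟶ toricVariety k σ :=
  monoidSchemeMap k (latticeMonoid_one_le l σ)

/-! ### Universal birational flattenings, F-blowups, normalizations -/

/-- `f : Y ⟶ X` is a proper birational morphism from an integral scheme such that
`(Y ×_X W)_red` is flat over `Y`. -/
structure IsBirationalFlattening {W X Y : Scheme.{u}} (g : W ⟶ X) (f : Y ⟶ X) : Prop where
  isIntegral : IsIntegral Y
  isProper : IsProper f
  birational : Scheme.BirationalOver f (𝟙 X)
  flat : Flat ((pullback f g).nilradical.subschemeι ≫ pullback.fst f g)

/-- `f : Y ⟶ X` is the universal birational flattening of `g : W ⟶ X`. -/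
structure IsUniversalBirationalFlattening {W X Y : Scheme.{u}} (g : W ⟶ X) (f : Y ⟶ X) :
    Prop where
  isFlattening : IsBirationalFlattening g f
  existsUnique_lift : ∀ (Y' : Scheme.{u}) (f' : Y' ⟶ X), IsBirationalFlattening g f' →
    ∃! h : Y' ⟶ Y, h ≫ f = f'

/-- `f : Y ⟶ X_σ` is the `(l)`-th F-blowup of `X_σ`. -/
def IsFBlowup (k : Type u) [Field k] {d : ℕ} (σ : PointedCone ℝ (Fin d → ℝ)) (l : ℕ+)
    {Y : Scheme.{u}} (f : Y ⟶ toricVariety k σ) : Prop :=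
  IsUniversalBirationalFlattening (frobeniusLike k l σ) f

/-- `ν : Z ⟶ Y` is the normalization of the integral scheme `Y`: `Z` is integral and normal, and
`ν` is integral and birational. -/
structure IsNormalization {Z Y : Scheme.{u}} (ν : Z ⟶ Y) : Prop where
  isIntegral : IsIntegral Z
  normal : ∀ z : Z, IsIntegrallyClosed (Z.presheaf.stalk z)
  isIntegralHom : IsIntegralHom ν
  birational : Scheme.BirationalOver ν (𝟙 Y)

/-! ### The fan and the toric divisors of a toric modification -/

/-- The scheme `Z` over `X_σ` is the toric variety of the fan `Δ`, with `π` the toric morphism: `Z`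
is glued over `X_σ` from the affine toric varieties `X_τ`, `τ ∈ Δ`, along the `X_{τ ∩ τ'}`. -/
def Fan.IsFanOf (k : Type u) [Field k] {d : ℕ} (Δ : Fan d) {σ : PointedCone ℝ (Fin d → ℝ)}
    {Z : Scheme.{u}} (π : Z ⟶ toricVariety k σ) : Prop :=
  ∃ (hle : ∀ τ ∈ Δ.cones, τ ≤ σ) (j : ∀ τ : Δ.cones, toricVariety k τ.1 ⟶ Z),
    (∀ τ, IsOpenImmersion (j τ)) ∧
    (∀ τ, j τ ≫ π = toricMap k (hle τ.1 τ.2)) ∧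
    (∀ (τ' τ : Δ.cones) (h : τ'.1 ≤ τ.1), toricMap k h ≫ j τ = j τ') ∧
    (∀ τ τ' : Δ.cones,
      Set.range (j τ) ∩ Set.range (j τ') = Set.range (j ⟨τ.1 ⊓ τ'.1, Δ.inf_mem τ.2 τ'.2⟩)) ∧
    ∀ z : Z, ∃ τ : Δ.cones, z ∈ Set.range (j τ)

/-- The toric prime divisor of the toric variety `X_ρ` of the ray `ρ = ℝ_{≥0} w`, i.e. its closed
torus orbit: the common zero locus of the monomials `x^m` with `(m, w) > 0`. -/
def toricDivisor (k : Type u) [Field k] {d : ℕ} (w : Fin d → ℤ) : Set (toricVariety k (ray w)) :=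
  PrimeSpectrum.zeroLocus {x : AddMonoidAlgebra k (latticeMonoid 1 (ray w)) |
    ∃ m : latticeMonoid 1 (ray w), 0 < m.1 ⬝ᵥ latticeVec w ∧ x = AddMonoidAlgebra.single m 1}

/-- The toric divisor over `X_σ` attached to `w` appears as a prime divisor on `Z`: the generic
point `e` of the toric divisor of `X_{ℝ_{≥0} w}` corresponds to a codimension-one point `z` of
`Z` under the natural birational map over `X_σ`, i.e. their local rings are isomorphic over
`X_σ`. -/
def AppearsAsPrimeDivisor (k : Type u) [Field k] {d : ℕ} {σ : PointedCone ℝ (Fin d → ℝ)}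
    {w : Fin d → ℤ} (hw : latticeVec w ∈ σ) {Z : Scheme.{u}} (π : Z ⟶ toricVariety k σ) : Prop :=
  ∃ (e : toricVariety k (ray w)) (z : Z), IsGenericPoint e (toricDivisor k w) ∧
    Order.coheight z = 1 ∧
    ∃ φ : (toricVariety k (ray w)).presheaf.stalk e ≅ Z.presheaf.stalk z,
      Spec.map φ.hom ≫ (toricVariety k (ray w)).fromSpecStalk e ≫ toricMap k (ray_le hw) =
        Z.fromSpecStalk z ≫ π

end FBlowup

end

noncomputable section

namespace FBlowup

/-! ### Lattice vectors and dual cones -/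

section Convex

variable {d : ℕ}

/-! Let `S = k[σ^∨ ∩ M]`, `T = k[σ^∨ ∩ (1/l)M]`, and let `O` be the local ring of the toric divisor
of `w`. An interior lattice point `a` of level one makes `x^a` a uniformizer, so `O` is a discrete
valuation ring. By the valuative criterion `Spec O → X` lifts to the normalization `Z` of the
F-blowup `Y`, so `O` dominates a local ring of `Z` and one of `Y`. It suffices that the one on `Y`
is all of `O`. It contains `S`, hence `x^a`, so only the monomials `x^b` with `b ∈ w^⊥ ∩ M` are
needed (`surjective_of_isLocalHom`).

Flatness supplies them. Let `c ∈ σ^∨ ∩ (1/l)M` have least level in its class modulo `M`, and let `c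
+ b ∈ σ^∨`. By minimality, extracting the class `c + M` and shifting by `-c` is an `S`-linear form
`T → O` with `x^c ↦ 1` (`shiftForm_mul`). For large `n` the relation `x^(na+b) · x^c = x^(na) ·
x^(c+b)` holds with coefficients in `S`. The equational criterion over the flat reduced base change,
followed by this form, gives `x^b = r'/r` with `r` a unit of `O` (`exists_isUnit_of_flat`,
`exists_isUnit_mul_rayMonomial`).

That enough such `b` exist is convex geometry (`perpLattice_le_closure`): translates of one open set
by `w^⊥ ∩ M` cover the connected space `ℝ^d`, and overlapping translates differ by an admissible
`b`. Admissibility holds on open sets of `c`, so points of `(1/l)M` realize a generating set for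
large `l`. Only finitely many `w` occur (`finite_setOf_level_one`), so one bound on `l` serves all
of them.

For the fan, `O` is then a local ring of some chart `X_τ`. Writing each `x^b` as a fraction there
produces enough supporting functionals of `τ` in `w^⊥` to cut out the ray as a face
(`ray_isFaceOf`). -/

@[simp] lemma latticeVec_zero : latticeVec (0 : Fin d → ℤ) = 0 := by
  funext i; simp [latticeVec]

lemma latticeVec_add (a b : Fin d → ℤ) : latticeVec (a + b) = latticeVec a + latticeVec b := by
  funext i; simp [latticeVec]

lemma latticeVec_neg (a : Fin d → ℤ) : latticeVec (-a) = -latticeVec a := by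
  funext i; simp [latticeVec]

lemma latticeVec_sub (a b : Fin d → ℤ) : latticeVec (a - b) = latticeVec a - latticeVec b := by
  funext i; simp [latticeVec]

lemma latticeVec_nsmul (n : ℕ) (a : Fin d → ℤ) : latticeVec (n • a) = (n : ℝ) • latticeVec a := by
  funext i; simp [latticeVec]

lemma latticeVec_zsmul (n : ℤ) (a : Fin d → ℤ) : latticeVec (n • a) = (n : ℝ) • latticeVec a := by
  funext i; simp [latticeVec]

lemma latticeVec_injective : Function.Injective (latticeVec (d := d)) := fun a b h => by
  funext i
  have := congrFun h i
  simpa [latticeVec] using this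

lemma latticeVec_dotProduct (a b : Fin d → ℤ) :
    latticeVec a ⬝ᵥ latticeVec b = ((a ⬝ᵥ b : ℤ) : ℝ) := by
  simp [latticeVec, dotProduct]

lemma smul_mem_dualCone {τ : PointedCone ℝ (Fin d → ℝ)} {a : Fin d → ℝ} (ha : a ∈ dualCone τ)
    {t : ℝ} (ht : 0 ≤ t) : t • a ∈ dualCone τ := by
  intro v hv
  rw [smul_dotProduct]
  exact mul_nonneg ht (ha v hv)

lemma mem_dualCone_hull {s : Set (Fin d → ℝ)} {a : Fin d → ℝ} :
    a ∈ dualCone (PointedCone.hull ℝ s) ↔ ∀ v ∈ s, 0 ≤ a ⬝ᵥ v := by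
  refine ⟨fun h v hv => h v (Submodule.subset_span hv), fun h v hv => ?_⟩
  induction hv using Submodule.span_induction with
  | mem x hx => exact h x hx
  | zero => simp
  | add x y _ _ hx hy => rw [dotProduct_add]; exact add_nonneg hx hy
  | smul c x _ hx =>
    have : a ⬝ᵥ (c • x) = (c : ℝ) * (a ⬝ᵥ x) := dotProduct_smul (c : ℝ) a x
    rw [this]
    exact mul_nonneg c.2 hx

lemma add_mem_interior_dualCone {σ : PointedCone ℝ (Fin d → ℝ)} {x y : Fin d → ℝ}
    (hx : x ∈ dualCone σ) (hy : y ∈ interior (dualCone σ : Set (Fin d → ℝ))) :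
    x + y ∈ interior (dualCone σ : Set (Fin d → ℝ)) := by
  rw [mem_interior_iff_mem_nhds] at hy ⊢
  have h : Filter.Tendsto (fun z => z - x) (nhds (x + y)) (nhds y) := by
    have : Filter.Tendsto (fun z => z - x) (nhds (x + y)) (nhds (x + y - x)) :=
      (continuous_id.sub continuous_const).tendsto _
    simpa using this
  filter_upwards [h hy] with z hz
  have : z = x + (z - x) := by abel
  rw [this]
  exact add_mem hx hz

lemma smul_mem_interior_dualCone {σ : PointedCone ℝ (Fin d → ℝ)} {y : Fin d → ℝ}
    (hy : y ∈ interior (dualCone σ : Set (Fin d → ℝ))) {t : ℝ} (ht : 0 < t) :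
    t • y ∈ interior (dualCone σ : Set (Fin d → ℝ)) := by
  rw [mem_interior_iff_mem_nhds] at hy ⊢
  have h : Filter.Tendsto (fun z => t⁻¹ • z) (nhds (t • y)) (nhds y) := by
    have : Filter.Tendsto (fun z : Fin d → ℝ => t⁻¹ • z) (nhds (t • y)) (nhds (t⁻¹ • t • y)) :=
      (continuous_const_smul _).tendsto _
    simpa [smul_smul, ht.ne'] using this
  filter_upwards [h hy] with z hz
  have : z = t • t⁻¹ • z := by simp [smul_smul, ht.ne']
  rw [this]
  exact smul_mem_dualCone hz ht.le

/-- Since `c/m + a → a`, the point `c/m + a` is eventually interior; then scale by `m`. This is what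
lets a high power of `x^a` clear denominators. -/
lemma exists_nat_add_smul_mem_interior {σ : PointedCone ℝ (Fin d → ℝ)} {a : Fin d → ℝ}
    (ha : a ∈ interior (dualCone σ : Set (Fin d → ℝ))) (c : Fin d → ℝ) :
    ∃ n : ℕ, ∀ m : ℕ, n ≤ m → c + (m : ℝ) • a ∈ interior (dualCone σ : Set (Fin d → ℝ)) := by
  have h : Filter.Tendsto (fun n : ℕ => (n : ℝ)⁻¹ • c + a) Filter.atTop (nhds a) := by
    have h1 : Filter.Tendsto (fun n : ℕ => (n : ℝ)⁻¹ • c + a) Filter.atTop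
        (nhds ((0 : ℝ) • c + a)) :=
      (tendsto_inv_atTop_nhds_zero_nat.smul_const c).add_const a
    simpa using h1
  obtain ⟨n, hn⟩ := Filter.eventually_atTop.mp (h (isOpen_interior.mem_nhds ha))
  -- The shift to `n + 1` guarantees `m > 0`.
  refine ⟨n + 1, fun m hm => ?_⟩
  have hm0 : (0 : ℝ) < m := by exact_mod_cast (by omega : 0 < m)
  have := smul_mem_interior_dualCone (hn m (by omega)) hm0
  simpa [smul_smul, hm0.ne'] using this

/-! ### Translations between minimal lattice points -/

/-- The lattice `w^⊥ ∩ M`. -/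
def perpLattice (w : Fin d → ℤ) : AddSubgroup (Fin d → ℤ) where
  carrier := {b | b ⬝ᵥ w = 0}
  zero_mem' := by simp
  add_mem' := by intro a b ha hb; simp_all [add_dotProduct]
  neg_mem' := by intro a ha; simp_all [neg_dotProduct]

lemma mem_perpLattice {w b : Fin d → ℤ} : b ∈ perpLattice w ↔ b ⬝ᵥ w = 0 := Iff.rfl

/-- `x ∈ σ^∨` has the least possible level `(x, w)` among the points of `(x + M) ∩ σ^∨`, and
`x + b ∈ σ^∨`. -/
def IsMinimalPair (σ : PointedCone ℝ (Fin d → ℝ)) (w b : Fin d → ℤ) (x : Fin d → ℝ) : Prop :=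
  x ∈ dualCone σ ∧ x + latticeVec b ∈ dualCone σ ∧
    ∀ m : Fin d → ℤ, m ⬝ᵥ w < 0 → x + latticeVec m ∉ dualCone σ

/-- Points `c` such that for some `t` the point `c + t a` is interior to the dual cone, while no
`w^⊥ ∩ M`-translate of `c + (t - 1) a` is. -/
def nearMinimal (σ : PointedCone ℝ (Fin d → ℝ)) (w a : Fin d → ℤ) : Set (Fin d → ℝ) :=
  {c | ∃ t : ℝ, c + t • latticeVec a ∈ interior (dualCone σ : Set (Fin d → ℝ)) ∧
    ∀ b ∈ perpLattice w,
      c + latticeVec b + (t - 1) • latticeVec a ∉ interior (dualCone σ : Set (Fin d → ℝ))}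

variable {σ : PointedCone ℝ (Fin d → ℝ)} {w a : Fin d → ℤ}

/-- Lowering the height slightly from `t` to `t'`, the points near `c` lie in the dual cone while
the translates one step lower do not. -/
lemma eventually_of_lt (ha : latticeVec a ∈ interior (dualCone σ : Set (Fin d → ℝ)))
    {c : Fin d → ℝ} {t t' : ℝ} (htt : t' < t)
    (h : ∀ b ∈ perpLattice w,
      c + latticeVec b + (t - 1) • latticeVec a ∉ interior (dualCone σ : Set (Fin d → ℝ))) :
    ∀ᶠ c' in nhds c, ∀ b ∈ perpLattice w,
      c' + latticeVec b + (t' - 1) • latticeVec a ∉ dualCone σ := by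
  -- The slack `(t - t') a` is interior, so it absorbs a small displacement `c' - c`, uniformly in
  -- `b`.
  have h1 : (t - t') • latticeVec a - 0 ∈ interior (dualCone σ : Set (Fin d → ℝ)) := by
    simpa using smul_mem_interior_dualCone ha (sub_pos.mpr htt)
  have h2 : Filter.Tendsto (fun c' => (t - t') • latticeVec a - (c' - c)) (nhds c)
      (nhds ((t - t') • latticeVec a - (c - c))) :=
    (continuous_const.sub (continuous_id.sub continuous_const)).tendsto _
  rw [sub_self] at h2
  filter_upwards [h2 (isOpen_interior.mem_nhds h1)] with c' hc' b hb hmem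
  refine h b hb ?_
  have := add_mem_interior_dualCone hmem hc'
  convert this using 1
  module

/-- For fixed `t` the non-membership condition need not be open in `c`. Lowering `t` slightly keeps
the open condition and makes the other one stable, by `eventually_of_lt`. -/
lemma isOpen_nearMinimal (ha : latticeVec a ∈ interior (dualCone σ : Set (Fin d → ℝ))) :
    IsOpen (nearMinimal σ w a) := by
  rw [isOpen_iff_mem_nhds]
  rintro c ⟨t, ht, hb⟩
  have hcont : Continuous fun p : ℝ × (Fin d → ℝ) => p.2 + p.1 • latticeVec a := by fun_prop
  have hopen := isOpen_interior.preimage hcont (t := interior (dualCone σ : Set (Fin d → ℝ)))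
  have h1 : ∀ᶠ p : ℝ × (Fin d → ℝ) in nhds t ×ˢ nhds c,
      p.2 + p.1 • latticeVec a ∈ interior (dualCone σ : Set (Fin d → ℝ)) := by
    rw [← nhds_prod_eq]
    exact hopen.mem_nhds (show (t, c) ∈ _ from ht)
  obtain ⟨p, hp, q, hq, hpq⟩ := Filter.eventually_prod_iff.mp h1
  obtain ⟨t', htt, hpt⟩ := ((Filter.Eventually.filter_mono nhdsWithin_le_nhds hp).and
    self_mem_nhdsWithin : ∀ᶠ t' in nhdsWithin t (Set.Iio t), p t' ∧ t' ∈ Set.Iio t).exists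
  filter_upwards [hq, eventually_of_lt ha hpt hb] with c' hc' h'
  exact ⟨t', hpq htt hc', fun b hb hmem => h' b hb (interior_subset hmem)⟩

/-- The heights at which some translate is interior are bounded below by the level. A height within
`1` of their infimum works, because one step lower falls below the infimum. -/
lemma exists_add_mem_nearMinimal (haw : a ⬝ᵥ w = 1) (hw : latticeVec w ∈ σ)
    (ha : latticeVec a ∈ interior (dualCone σ : Set (Fin d → ℝ))) (c : Fin d → ℝ) :
    ∃ b ∈ perpLattice w, c + latticeVec b ∈ nearMinimal σ w a := by
  let T : Set ℝ := {t | ∃ b ∈ perpLattice w,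
    c + latticeVec b + t • latticeVec a ∈ interior (dualCone σ : Set (Fin d → ℝ))}
  have hne : T.Nonempty := by
    obtain ⟨n, hn⟩ := exists_nat_add_smul_mem_interior ha c
    exact ⟨n, 0, zero_mem _, by simpa using hn n le_rfl⟩
  have hbdd : BddBelow T := by
    refine ⟨-(c ⬝ᵥ latticeVec w), ?_⟩
    rintro t ⟨b, hb, ht⟩
    have := interior_subset ht _ hw
    rw [add_dotProduct, add_dotProduct, smul_dotProduct, latticeVec_dotProduct,
      latticeVec_dotProduct, haw, mem_perpLattice.mp hb] at this
    simp at this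
    linarith
  obtain ⟨t, ⟨b, hb, ht⟩, hlt⟩ := exists_lt_of_csInf_lt hne (lt_add_one (sInf T))
  refine ⟨b, hb, t, ht, fun b' hb' hmem => ?_⟩
  have : t - 1 ∈ T := ⟨b + b', add_mem hb hb', by rwa [latticeVec_add, ← add_assoc]⟩
  linarith [csInf_le hbdd this]

lemma zero_mem_nearMinimal (haw : a ⬝ᵥ w = 1) (hw : latticeVec w ∈ σ)
    (ha : latticeVec a ∈ interior (dualCone σ : Set (Fin d → ℝ))) :
    (0 : Fin d → ℝ) ∈ nearMinimal σ w a := by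
  -- At height `1/2` the point `a/2` is interior, while one step lower every translate has level
  -- `-1/2 < 0`.
  refine ⟨1 / 2, by simpa using smul_mem_interior_dualCone ha (by norm_num : (0 : ℝ) < 1 / 2),
    fun b hb hmem => ?_⟩
  have := interior_subset hmem _ hw
  rw [add_dotProduct, add_dotProduct, smul_dotProduct, latticeVec_dotProduct,
    latticeVec_dotProduct, haw, mem_perpLattice.mp hb] at this
  norm_num at this

/-- At the larger of the two heights both `c` and `c + b` become interior, and the condition one
step lower survives because it is invariant under `w^⊥ ∩ M`. After a further slight lowering to
`t'`, all points near `c + t' a` are minimal. -/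
lemma exists_isOpen_isMinimalPair (haw : a ⬝ᵥ w = 1)
    (ha : latticeVec a ∈ interior (dualCone σ : Set (Fin d → ℝ)))
    {b : Fin d → ℤ} (hb : b ∈ perpLattice w) {c : Fin d → ℝ} (hc : c ∈ nearMinimal σ w a)
    (hcb : c + latticeVec b ∈ nearMinimal σ w a) :
    ∃ U : Set (Fin d → ℝ), IsOpen U ∧ U.Nonempty ∧ ∀ x ∈ U, IsMinimalPair σ w b x := by
  obtain ⟨t₁, h₁, h₁'⟩ := hc
  obtain ⟨t₂, h₂, h₂'⟩ := hcb
  have mono : ∀ {x : Fin d → ℝ} {s s' : ℝ}, s ≤ s' →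
      x + s • latticeVec a ∈ interior (dualCone σ : Set (Fin d → ℝ)) →
      x + s' • latticeVec a ∈ interior (dualCone σ : Set (Fin d → ℝ)) := by
    intro x s s' hs hx
    have := add_mem_interior_dualCone
      (smul_mem_dualCone (interior_subset ha) (sub_nonneg.mpr hs)) hx
    convert this using 1
    module
  obtain ⟨t, ht, htb, ht'⟩ : ∃ t : ℝ,
      c + t • latticeVec a ∈ interior (dualCone σ : Set (Fin d → ℝ)) ∧
      c + latticeVec b + t • latticeVec a ∈ interior (dualCone σ : Set (Fin d → ℝ)) ∧
      ∀ b ∈ perpLattice w,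
        c + latticeVec b + (t - 1) • latticeVec a ∉ interior (dualCone σ : Set (Fin d → ℝ)) := by
    rcases le_total t₁ t₂ with h | h
    · refine ⟨t₂, mono h h₁, h₂, fun b' hb' hmem => h₂' (b' - b) (sub_mem hb' hb) ?_⟩
      rw [latticeVec_sub]
      convert hmem using 1
      abel
    · exact ⟨t₁, h₁, mono h h₂, h₁'⟩
  have key : ∀ᶠ t' in nhdsWithin t (Set.Iio t), t' ∈ Set.Iio t ∧
      c + t' • latticeVec a ∈ interior (dualCone σ : Set (Fin d → ℝ)) ∧
      c + latticeVec b + t' • latticeVec a ∈ interior (dualCone σ : Set (Fin d → ℝ)) := by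
    have aux : ∀ x : Fin d → ℝ,
        x + t • latticeVec a ∈ interior (dualCone σ : Set (Fin d → ℝ)) →
        ∀ᶠ t' in nhdsWithin t (Set.Iio t),
          x + t' • latticeVec a ∈ interior (dualCone σ : Set (Fin d → ℝ)) := by
      intro x hx
      have hcont : Continuous fun s : ℝ => x + s • latticeVec a := by fun_prop
      exact Filter.Eventually.filter_mono nhdsWithin_le_nhds
        ((isOpen_interior.preimage hcont).mem_nhds hx)
    filter_upwards [self_mem_nhdsWithin, aux _ ht, aux _ htb] with t' h h' h''
    exact ⟨h, h', h''⟩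
  obtain ⟨t', htt, hx, hxb⟩ := key.exists
  have hC : ∀ᶠ x in nhds (c + t' • latticeVec a), IsMinimalPair σ w b x := by
    have e1 : ∀ᶠ x in nhds (c + t' • latticeVec a), x ∈ dualCone σ :=
      mem_interior_iff_mem_nhds.mp hx
    have e2 : ∀ᶠ x in nhds (c + t' • latticeVec a), x + latticeVec b ∈ dualCone σ := by
      have hcont : Continuous fun x : Fin d → ℝ => x + latticeVec b := by fun_prop
      refine (hcont.tendsto _) (mem_interior_iff_mem_nhds.mp ?_)
      convert hxb using 1
      abel
    have e3 : ∀ᶠ x in nhds (c + t' • latticeVec a), ∀ b ∈ perpLattice w,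
        (x - t' • latticeVec a) + latticeVec b + (t' - 1) • latticeVec a ∉ dualCone σ := by
      have hcont : Continuous fun x : Fin d → ℝ => x - t' • latticeVec a := by fun_prop
      have := hcont.tendsto (c + t' • latticeVec a)
      rw [add_sub_cancel_right] at this
      exact this.eventually (eventually_of_lt ha htt ht')
    filter_upwards [e1, e2, e3] with x h1 h2 h3
    refine ⟨h1, h2, fun m hm hmem => ?_⟩
    -- If `x + m` were in the cone with `m` of level `-(n+1)`, adding `n a` would give a point one
    -- step below a `w^⊥ ∩ M`-translate of `x`, which is excluded.
    obtain ⟨n, hn⟩ : ∃ n : ℕ, m ⬝ᵥ w = -(n + 1 : ℤ) := ⟨(-(m ⬝ᵥ w) - 1).toNat, by omega⟩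
    have hb' : m + (n + 1) • a ∈ perpLattice w := by
      rw [mem_perpLattice, add_dotProduct, hn, smul_dotProduct, haw]
      simp
    refine h3 _ hb' ?_
    have := add_mem hmem (smul_mem_dualCone (interior_subset ha) (Nat.cast_nonneg n))
    convert this using 1
    rw [latticeVec_add, latticeVec_nsmul]
    push_cast
    module
  obtain ⟨U, hU, hUo, hmem⟩ := eventually_nhds_iff.mp hC
  exact ⟨U, hUo, ⟨_, hmem⟩, hU⟩

/-- The translations between minimal points filling out an open set generate `w^⊥ ∩ M`. -/
theorem perpLattice_le_closure (haw : a ⬝ᵥ w = 1) (hw : latticeVec w ∈ σ)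
    (ha : latticeVec a ∈ interior (dualCone σ : Set (Fin d → ℝ))) :
    perpLattice w ≤ AddSubgroup.closure {b | b ∈ perpLattice w ∧
      ∃ U : Set (Fin d → ℝ), IsOpen U ∧ U.Nonempty ∧ ∀ x ∈ U, IsMinimalPair σ w b x} := by
  set H := AddSubgroup.closure {b | b ∈ perpLattice w ∧
      ∃ U : Set (Fin d → ℝ), IsOpen U ∧ U.Nonempty ∧ ∀ x ∈ U, IsMinimalPair σ w b x} with hH
  by_contra hcon
  obtain ⟨b₀, hb₀, hb₀H⟩ := Set.not_subset.mp hcon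
  have hHL : H ≤ perpLattice w := (AddSubgroup.closure_le _).mpr fun b hb => hb.1
  let W := nearMinimal σ w a
  have hopen : ∀ Q : Set (Fin d → ℤ), IsOpen {c | ∃ b ∈ Q, c + latticeVec b ∈ W} := by
    intro Q
    have : {c | ∃ b ∈ Q, c + latticeVec b ∈ W} =
        ⋃ b ∈ Q, (fun c => c + latticeVec b) ⁻¹' W := by ext; simp
    rw [this]
    exact isOpen_biUnion fun b _ => (isOpen_nearMinimal ha).preimage (by fun_prop)
  -- Were `H` proper, the translations in `H` and those outside `H` would give two nonempty open
  -- sets covering `ℝ^d`. By connectedness they meet, and at a common point the two translations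
  -- differ by a generator of `H`.
  have hpre := (isPreconnected_univ (α := Fin d → ℝ)) _ _ (hopen (H : Set (Fin d → ℤ)))
    (hopen ((perpLattice w : Set (Fin d → ℤ)) \ H)) ?_ ?_ ?_
  · obtain ⟨c, -, ⟨h, hh, hc⟩, b, ⟨hb, hbH⟩, hcb⟩ := hpre
    have hbh : b - h ∈ perpLattice w := sub_mem hb (hHL hh)
    have : b - h ∈ H := AddSubgroup.subset_closure ⟨hbh,
      exists_isOpen_isMinimalPair haw ha hbh hc (by
        rw [latticeVec_sub]
        convert hcb using 1
        abel)⟩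
    exact hbH (by simpa using add_mem this hh)
  · intro c _
    obtain ⟨b, hb, hcb⟩ := exists_add_mem_nearMinimal haw hw ha c
    by_cases hbH : b ∈ H
    · exact Or.inl ⟨b, hbH, hcb⟩
    · exact Or.inr ⟨b, ⟨hb, hbH⟩, hcb⟩
  · exact ⟨0, trivial, 0, zero_mem H, by simpa using zero_mem_nearMinimal haw hw ha⟩
  · exact ⟨-latticeVec b₀, trivial, b₀, ⟨hb₀, hb₀H⟩, by
      simpa using zero_mem_nearMinimal haw hw ha⟩

/-! ### Uniformity in `l` and finiteness of the set of rays. -/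

/-- Rounding `l x` down coordinatewise gives points of `(1/l)M` that converge to `x`. -/
lemma exists_lattice_point_mem {U : Set (Fin d → ℝ)} (hU : IsOpen U) (hne : U.Nonempty) :
    ∃ l₀ : ℕ, ∀ l : ℕ, l₀ ≤ l → 0 < l →
      ∃ x ∈ U, ∃ m : Fin d → ℤ, (l : ℝ) • x = latticeVec m := by
  obtain ⟨x, hx⟩ := hne
  have h : Filter.Tendsto (fun l : ℕ => fun i => (⌊(l : ℝ) * x i⌋ : ℝ) / l) Filter.atTop
      (nhds x) := by
    rw [tendsto_pi_nhds]
    intro i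
    have h1 := (tendsto_nat_floor_mul_div_atTop (R := ℝ) (a := 1) zero_le_one)
    have h2 : Filter.Tendsto (fun l : ℕ => x i - 1 / (l : ℝ)) Filter.atTop (nhds (x i - 0)) :=
      tendsto_const_nhds.sub tendsto_one_div_atTop_nhds_zero_nat
    rw [sub_zero] at h2
    refine tendsto_of_tendsto_of_tendsto_of_le_of_le' h2 tendsto_const_nhds ?_ ?_
    · filter_upwards [Filter.eventually_gt_atTop 0] with l hl
      have hl' : (0 : ℝ) < l := by exact_mod_cast hl
      rw [le_div_iff₀ hl', sub_mul, one_div, inv_mul_cancel₀ hl'.ne']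
      linarith [Int.lt_floor_add_one ((l : ℝ) * x i)]
    · filter_upwards [Filter.eventually_gt_atTop 0] with l hl
      have hl' : (0 : ℝ) < l := by exact_mod_cast hl
      rw [div_le_iff₀ hl']
      linarith [Int.floor_le ((l : ℝ) * x i)]
  obtain ⟨l₀, hl₀⟩ := Filter.eventually_atTop.mp (h (hU.mem_nhds hx))
  refine ⟨l₀, fun l hl hpos => ⟨_, hl₀ l hl, fun i => ⌊(l : ℝ) * x i⌋, ?_⟩⟩
  have hl' : (l : ℝ) ≠ 0 := by exact_mod_cast hpos.ne'
  funext i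
  simp [latticeVec, mul_div_cancel₀, hl']

/-- For large `l`, the translations between minimal points of `(1/l)·M` generate `w^⊥ ∩ M`. -/
theorem exists_forall_perpLattice_le_closure (haw : a ⬝ᵥ w = 1) (hw : latticeVec w ∈ σ)
    (ha : latticeVec a ∈ interior (dualCone σ : Set (Fin d → ℝ))) :
    ∃ l₀ : ℕ, ∀ l : ℕ+, l₀ ≤ l →
      perpLattice w ≤ AddSubgroup.closure {b | b ∈ perpLattice w ∧
        ∃ x ∈ latticeMonoid l σ, IsMinimalPair σ w b x} := by
  obtain ⟨s, hs⟩ : (perpLattice w).FG := by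
    have h := IsNoetherian.noetherian (AddSubgroup.toIntSubmodule (perpLattice w))
    rw [← AddSubgroup.toIntSubmodule_toAddSubgroup (perpLattice w)]
    exact (Submodule.fg_iff_addSubgroup_fg _).mp h
  set G := {b | b ∈ perpLattice w ∧
      ∃ U : Set (Fin d → ℝ), IsOpen U ∧ U.Nonempty ∧ ∀ x ∈ U, IsMinimalPair σ w b x}
  -- An element of the closure involves finitely many generators, hence has its own threshold; a
  -- finite generating set of `w^⊥ ∩ M` then has a common one.
  have step : ∀ b ∈ AddSubgroup.closure G, ∃ l₀ : ℕ, ∀ l : ℕ+, l₀ ≤ l →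
      b ∈ AddSubgroup.closure {b | b ∈ perpLattice w ∧
        ∃ x ∈ latticeMonoid l σ, IsMinimalPair σ w b x} := by
    intro b hb
    induction hb using AddSubgroup.closure_induction with
    | mem b hb =>
      obtain ⟨hb, U, hU, hne, hUx⟩ := hb
      obtain ⟨l₀, hl₀⟩ := exists_lattice_point_mem hU hne
      refine ⟨l₀, fun l hl => AddSubgroup.subset_closure ⟨hb, ?_⟩⟩
      obtain ⟨x, hx, m, hm⟩ := hl₀ l hl l.pos
      exact ⟨x, ⟨(hUx x hx).1, m, hm⟩, hUx x hx⟩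
    | zero => exact ⟨0, fun l _ => zero_mem _⟩
    | add b b' _ _ hb hb' =>
      obtain ⟨l₁, h₁⟩ := hb
      obtain ⟨l₂, h₂⟩ := hb'
      exact ⟨max l₁ l₂, fun l hl => add_mem (h₁ l (le_of_max_le_left hl))
        (h₂ l (le_of_max_le_right hl))⟩
    | neg b _ hb =>
      obtain ⟨l₁, h₁⟩ := hb
      exact ⟨l₁, fun l hl => neg_mem (h₁ l hl)⟩
  have hsG : ∀ b ∈ s, b ∈ AddSubgroup.closure G := fun b hb =>
    perpLattice_le_closure haw hw ha (hs ▸ AddSubgroup.subset_closure hb)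
  choose! f hf using fun b (hb : b ∈ s) => step b (hsG b hb)
  refine ⟨s.sup f, fun l hl => ?_⟩
  refine hs.symm.le.trans ((AddSubgroup.closure_le _).mpr ?_)
  exact fun b hb => hf b hb l ((Finset.le_sup hb).trans hl)

/-- For some `n ≥ 1` the point `n a - v` lies in the dual cone, so `n (a, v) ≥ (v, v) > 0`. -/
lemma dotProduct_pos_of_mem_interior {σ : PointedCone ℝ (Fin d → ℝ)} {a v : Fin d → ℝ}
    (ha : a ∈ interior (dualCone σ : Set (Fin d → ℝ))) (hv : v ∈ σ) (hv0 : v ≠ 0) :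
    0 < a ⬝ᵥ v := by
  obtain ⟨n, hn⟩ := exists_nat_add_smul_mem_interior ha (-v)
  have h := interior_subset (hn (n + 1) (by omega)) v hv
  rw [add_dotProduct, neg_dotProduct, smul_dotProduct, smul_eq_mul] at h
  have hvv : 0 < v ⬝ᵥ v := lt_of_le_of_ne (Finset.sum_nonneg fun i _ => mul_self_nonneg _)
    (fun h0 => hv0 (dotProduct_self_eq_zero.mp h0.symm))
  have hpos : (0 : ℝ) < ((n + 1 : ℕ) : ℝ) := by positivity
  by_contra hcon
  nlinarith [mul_nonpos_of_nonneg_of_nonpos hpos.le (not_lt.mp hcon)]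

/-- Only finitely many `w ∈ σ` have level one at some interior lattice point of the dual cone. -/
theorem finite_setOf_level_one (hrat : IsRationalPolyhedral σ) :
    {w : Fin d → ℤ | latticeVec w ∈ σ ∧ ∃ a : Fin d → ℤ,
      latticeVec a ∈ interior (dualCone σ : Set (Fin d → ℝ)) ∧ a ⬝ᵥ w = 1}.Finite := by
  obtain ⟨s, rfl⟩ := hrat
  -- A nonzero generator `v` has integral level `(a, v) ≥ 1`, so `|v_i| ≤ K_i (a, v)`, and this
  -- bound passes to the whole cone. At level one it confines `w` to a box independent of `a`.
  let K : Fin d → ℤ := ∑ v ∈ s, |v|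
  have hK : ∀ v ∈ s, ∀ i, |v i| ≤ K i := fun v hv i => by
    simp only [K, Finset.sum_apply]
    exact Finset.single_le_sum (f := fun v : Fin d → ℤ => |v| i) (fun v _ => abs_nonneg _) hv
  refine (Set.finite_Icc (-K) K).subset ?_
  rintro w ⟨hw, a, ha, haw⟩
  suffices h : ∀ x ∈ PointedCone.hull ℝ (latticeVec '' (s : Set (Fin d → ℤ))), ∀ i,
      |x i| ≤ K i * (latticeVec a ⬝ᵥ x) by
    have hi : ∀ i, |w i| ≤ K i := fun i => by
      have := h _ hw i
      rw [latticeVec_dotProduct, haw] at this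
      simp only [latticeVec] at this
      exact_mod_cast (by simpa using this : |(w i : ℝ)| ≤ K i)
    exact ⟨fun i => (abs_le.mp (hi i)).1, fun i => (abs_le.mp (hi i)).2⟩
  intro x hx i
  induction hx using Submodule.span_induction with
  | mem x hx =>
    have hxσ := Submodule.subset_span (R := {c : ℝ // 0 ≤ c}) hx
    obtain ⟨v, hv, rfl⟩ := hx
    rcases eq_or_ne v 0 with rfl | hv0
    · simp
    · have hpos := dotProduct_pos_of_mem_interior ha hxσ
        (fun h => hv0 (latticeVec_injective (by simpa using h)))
      rw [latticeVec_dotProduct] at hpos ⊢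
      have h1 : (1 : ℤ) ≤ a ⬝ᵥ v := by exact_mod_cast hpos
      have h2 : |v i| ≤ K i * (a ⬝ᵥ v) := by nlinarith [hK v hv i, abs_nonneg (v i)]
      simp only [latticeVec]
      exact_mod_cast h2
  | zero => simp
  | add x y _ _ hx hy =>
    rw [dotProduct_add, mul_add]
    exact (abs_add_le _ _).trans (add_le_add hx hy)
  | smul c x _ hx =>
    have h1 : latticeVec a ⬝ᵥ (c • x) = (c : ℝ) * (latticeVec a ⬝ᵥ x) :=
      dotProduct_smul (c : ℝ) _ x
    have h2 : (c • x) i = (c : ℝ) * x i := rfl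
    rw [h1, h2, abs_mul, abs_of_nonneg c.2]
    nlinarith [mul_le_mul_of_nonneg_left hx c.2]

end Convex

/-! ### Flatness of the reduced base change -/

section FlatReduced

variable {S T R P B O Ω : Type*} [CommRing S] [CommRing T] [CommRing R] [CommRing P] [CommRing B]
  [CommRing O] [CommRing Ω] [Algebra S T] [Algebra S R] [Algebra S P] [Algebra R P] [Algebra T P]
  [IsScalarTower S R P] [IsScalarTower S T P] [Algebra R O] [Algebra S O] [IsScalarTower S R O]

/-- If every element of `O` is a fraction of elements of `S`, then nilpotents of `R ⊗ T` are
killed by the `R`-linear extension of an `S`-linear map `T → O`. -/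
lemma baseChangeLift_eq_zero_of_isNilpotent [IsDomain O] [IsReduced Ω]
    [hP : Algebra.IsPushout S R T P]
    (hinj : Function.Injective (algebraMap R O))
    (hfrac : ∀ z : O, ∃ s s' : S, algebraMap S O s ≠ 0 ∧
      algebraMap S O s * z = algebraMap S O s')
    (iO : O →+* Ω) (iT : T →+* Ω) (hiT : Function.Injective iT)
    (hi : ∀ s, iO (algebraMap S O s) = iT (algebraMap S T s))
    (θ : T →ₗ[S] O) {x : P} (hx : IsNilpotent x) : hP.out.lift θ x = 0 := by
  -- Up to a denominator from `S`, every element of `R ⊗ T` comes from `T`.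
  have hfracP : ∀ x : P, ∃ s : S, algebraMap S O s ≠ 0 ∧ ∃ τ : T, s • x = algebraMap T P τ := by
    intro x
    refine hP.out.inductionOn x _ ⟨1, by simp, 0, by simp⟩ (fun τ => ⟨1, by simp, τ, by simp⟩) ?_ ?_
    · rintro r y ⟨s, hs, τ, hτ⟩
      obtain ⟨s₁, s₁', h₁, h₁'⟩ := hfrac (algebraMap R O r)
      have hr : algebraMap S R s₁ * r = algebraMap S R s₁' := hinj (by
        rw [map_mul, ← IsScalarTower.algebraMap_apply, ← IsScalarTower.algebraMap_apply, h₁'])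
      refine ⟨s₁ * s, by rw [map_mul]; exact mul_ne_zero h₁ hs, s₁' • τ, ?_⟩
      have e1 : (s₁ * s) • r • y = (algebraMap S R s₁ * r) • s • y := by
        rw [← algebraMap_smul R (s₁ * s) (r • y), ← algebraMap_smul R s y, smul_smul, smul_smul,
          map_mul]
        congr 1
        ring
      rw [e1, hr, hτ, algebraMap_smul, Algebra.algebraMap_eq_smul_one τ,
        Algebra.algebraMap_eq_smul_one (s₁' • τ), smul_assoc]
    · rintro y z ⟨s, hs, τ, hτ⟩ ⟨s', hs', τ', hτ'⟩
      refine ⟨s * s', by rw [map_mul]; exact mul_ne_zero hs hs', s' • τ + s • τ', ?_⟩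
      have e : ∀ (s : S) (τ : T), algebraMap T P (s • τ) = s • algebraMap T P τ := fun s τ => by
        rw [Algebra.algebraMap_eq_smul_one τ, Algebra.algebraMap_eq_smul_one (s • τ), smul_assoc]
      rw [map_add, e, e, ← hτ, ← hτ', smul_add, smul_smul, smul_smul, mul_comm s' s]
  let : Algebra S Ω := (iO.comp (algebraMap S O)).toAlgebra
  let gO : R →ₐ[S] Ω := { iO.comp (algebraMap R O) with
    commutes' := fun s => by
      change iO (algebraMap R O (algebraMap S R s)) = iO (algebraMap S O s)
      rw [← IsScalarTower.algebraMap_apply] }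
  let gT : T →ₐ[S] Ω := { iT with commutes' := fun s => (hi s).symm }
  let J : P →ₐ[S] Ω := Algebra.pushoutDesc P gO gT (fun _ _ => mul_comm _ _)
  -- The numerator `τ` of a nilpotent maps to a nilpotent of the reduced ring `Ω`, into which `T`
  -- embeds, so `τ = 0`.
  obtain ⟨s, hs, τ, hτ⟩ := hfracP x
  have hτ0 : τ = 0 := by
    refine hiT ?_
    have h1 : J (algebraMap T P τ) = iT τ := Algebra.pushoutDesc_right P gO gT _ τ
    have h2 : IsNilpotent (s • x) := hx.smul s
    rw [hτ] at h2
    rw [map_zero, ← h1]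
    exact (h2.map J).eq_zero
  have h3 : s • hP.out.lift θ x = 0 := by
    rw [← algebraMap_smul R, ← map_smul, algebraMap_smul, hτ, hτ0, map_zero, map_zero]
  rw [Algebra.smul_def] at h3
  exact (mul_eq_zero.mp h3).resolve_left hs

/-- Let `R ⊆ O` with `O` local, and suppose that `(R ⊗_S T)_red` is flat over `R`. If
`p' t = p t'` in `T` and some `S`-linear form `T → O` takes a unit value at `t`, then `p' / p` is a
fraction of elements of `R` with denominator a unit of `O`. -/
theorem exists_isUnit_of_flat [IsDomain O] [IsLocalRing O] [IsReduced Ω]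
    [hP : Algebra.IsPushout S R T P]
    (hinj : Function.Injective (algebraMap R O))
    (hfrac : ∀ z : O, ∃ s s' : S, algebraMap S O s ≠ 0 ∧
      algebraMap S O s * z = algebraMap S O s')
    (iO : O →+* Ω) (iT : T →+* Ω) (hiT : Function.Injective iT)
    (hi : ∀ s, iO (algebraMap S O s) = iT (algebraMap S T s))
    [Algebra R B] [Module.Flat R B] (q : P →ₐ[R] B) (hq : Function.Surjective q)
    (hker : ∀ x, q x = 0 → IsNilpotent x)
    (θ : T →ₗ[S] O) {t t' : T} (hθ : IsUnit (θ t)) {p p' : S} (h : p' • t = p • t') :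
    ∃ r r' : R, IsUnit (algebraMap R O r) ∧
      algebraMap S O p' * algebraMap R O r = algebraMap S O p * algebraMap R O r' := by
  -- The identity `p' t = p t'` becomes an `R`-linear relation in the flat module `B`. The
  -- equational criterion writes `t = ∑ a₀ⱼ yⱼ` in `B` with `p' a₀ⱼ = p a₁ⱼ`.
  have hrel : ∑ i, ![algebraMap S R p', -algebraMap S R p] i •
      ![q (algebraMap T P t), q (algebraMap T P t')] i = 0 := by
    have e : ∀ (s : S) (τ : T), algebraMap T P (s • τ) = s • algebraMap T P τ := fun s τ => by
      rw [Algebra.algebraMap_eq_smul_one τ, Algebra.algebraMap_eq_smul_one (s • τ), smul_assoc]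
    simp only [Fin.sum_univ_two, Matrix.cons_val_zero, Matrix.cons_val_one]
    rw [neg_smul, ← map_smul q, ← map_smul q, algebraMap_smul R p', algebraMap_smul R p, ← e, ← e,
      h, add_neg_cancel]
  obtain ⟨k, a, y, hy, ha⟩ := Module.Flat.isTrivialRelation_of_sum_smul_eq_zero (R := R)
    (M := B) hrel
  choose z hz using fun j => hq (y j)
  have hnil : IsNilpotent (algebraMap T P t - ∑ j, a 0 j • z j) := by
    refine hker _ ?_
    have := hy 0
    simp only [Matrix.cons_val_zero] at this
    rw [map_sub, this, map_sum]
    simp [hz]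
  have hsum := baseChangeLift_eq_zero_of_isNilpotent hinj hfrac iO iT hiT hi θ hnil
  have hθt : hP.out.lift θ (algebraMap T P t) = θ t := hP.out.lift_eq θ t
  rw [map_sub, hθt, sub_eq_zero, map_sum] at hsum
  rw [hsum] at hθ
  -- The unit `θ t` is a combination of the `a₀ⱼ`, so in the local ring `O` one of them is a unit.
  obtain ⟨j, hj⟩ : ∃ j, IsUnit (algebraMap R O (a 0 j)) := by
    by_contra! hcon
    refine (IsLocalRing.mem_maximalIdeal _).mp (Ideal.sum_mem _ fun j _ => ?_) hθ
    rw [map_smul, Algebra.smul_def]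
    exact Ideal.mul_mem_right _ _ ((IsLocalRing.mem_maximalIdeal _).mpr (hcon j))
  refine ⟨a 0 j, a 1 j, hj, ?_⟩
  have := congrArg (algebraMap R O) (ha j)
  simp only [Fin.sum_univ_two, Matrix.cons_val_zero, Matrix.cons_val_one] at this
  rw [map_add, map_mul, map_mul, map_neg, map_zero, ← IsScalarTower.algebraMap_apply,
    ← IsScalarTower.algebraMap_apply, neg_mul, ← sub_eq_add_neg, sub_eq_zero] at this
  exact this

end FlatReduced

/-! ### The local ring of a toric divisor -/

/-- A localization of a domain at a principal prime `(p)` is a discrete valuation ring when every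
nonzero element is divisible by `p` only finitely often. -/
theorem isDiscreteValuationRing_of_isLocalization_span_singleton {A O : Type*} [CommRing A]
    [IsDomain A] [CommRing O] [IsDomain O] [Algebra A O] {p : A} {P : Ideal A} [P.IsPrime]
    [IsLocalization.AtPrime O P] (hP : P = Ideal.span {p}) (hp : p ≠ 0)
    (hfin : ∀ f : A, f ≠ 0 → FiniteMultiplicity p f) : IsDiscreteValuationRing O := by
  have hinj : Function.Injective (algebraMap A O) :=
    IsLocalization.injective O P.primeCompl_le_nonZeroDivisors
  have := IsLocalization.AtPrime.isLocalRing O P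
  have hmax : IsLocalRing.maximalIdeal O = Ideal.span {algebraMap A O p} := by
    rw [← IsLocalization.AtPrime.map_eq_maximalIdeal P O, hP, Ideal.map_span, Set.image_singleton]
  refine IsDiscreteValuationRing.ofHasUnitMulPowIrreducibleFactorization
    ⟨algebraMap A O p, IsDiscreteValuationRing.irreducible_of_span_eq_maximalIdeal _
      (by rwa [Ne, map_eq_zero_iff _ hinj]) hmax, fun {x} hx => ?_⟩
  obtain ⟨⟨f, s⟩, hfs⟩ := IsLocalization.surj P.primeCompl x
  have hs : IsUnit (algebraMap A O s) := IsLocalization.map_units O s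
  have hf : f ≠ 0 := by
    rintro rfl
    rw [map_zero] at hfs
    exact hx ((hs.mul_left_eq_zero).mp hfs)
  obtain ⟨c, hc, hpc⟩ := (hfin f hf).exists_eq_pow_mul_and_not_dvd
  have hcu : IsUnit (algebraMap A O c) := IsLocalization.map_units O (⟨c, by
    rw [Ideal.mem_primeCompl_iff, hP, Ideal.mem_span_singleton]
    exact hpc⟩ : P.primeCompl)
  refine ⟨multiplicity p f, ?_⟩
  have h1 : Associated (algebraMap A O p ^ multiplicity p f) (algebraMap A O f) := by
    rw [hc]
    simp only [map_mul, map_pow]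
    rw [← hc]
    exact (associated_mul_unit_right _ _ hcu)
  refine h1.trans ?_
  change x * algebraMap A O s = algebraMap A O f at hfs
  rw [← hfs]
  exact (associated_mul_unit_left _ _ hs)

/-! ### Monoid algebras and the prime ideal of the toric divisor. -/

section MonoidAlgebra

variable (k : Type u) [Field k] {d : ℕ}

lemma mem_latticeMonoid_one {τ : PointedCone ℝ (Fin d → ℝ)} {x : Fin d → ℝ} :
    x ∈ latticeMonoid 1 τ ↔ x ∈ dualCone τ ∧ ∃ m : Fin d → ℤ, x = latticeVec m := by
  change (_ ∧ _) ↔ _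
  simp

lemma latticeVec_mem_latticeMonoid_one {τ : PointedCone ℝ (Fin d → ℝ)} {m : Fin d → ℤ} :
    latticeVec m ∈ latticeMonoid 1 τ ↔ latticeVec m ∈ dualCone τ := by
  rw [mem_latticeMonoid_one]
  exact ⟨fun h => h.1, fun h => ⟨h, m, rfl⟩⟩

lemma mem_dualCone_ray {w : Fin d → ℤ} {x : Fin d → ℝ} :
    x ∈ dualCone (ray w) ↔ 0 ≤ x ⬝ᵥ latticeVec w := by
  rw [ray, mem_dualCone_hull]
  simp

lemma latticeVec_mem_latticeMonoid_ray {w m : Fin d → ℤ} :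
    latticeVec m ∈ latticeMonoid 1 (ray w) ↔ 0 ≤ m ⬝ᵥ w := by
  rw [latticeVec_mem_latticeMonoid_one, mem_dualCone_ray, latticeVec_dotProduct]
  exact Int.cast_nonneg_iff

/-- The inclusion of `k[S]` into the group algebra of the ambient vector space. -/
def toGroupAlgebra (S : AddSubmonoid (Fin d → ℝ)) :
    AddMonoidAlgebra k S →+* AddMonoidAlgebra k (Fin d → ℝ) :=
  AddMonoidAlgebra.mapDomainRingHom k S.subtype

lemma toGroupAlgebra_injective (S : AddSubmonoid (Fin d → ℝ)) :
    Function.Injective (toGroupAlgebra k S) :=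
  AddMonoidAlgebra.mapDomain_injective Subtype.val_injective

@[simp] lemma toGroupAlgebra_single (S : AddSubmonoid (Fin d → ℝ)) (m : S) (r : k) :
    toGroupAlgebra k S (AddMonoidAlgebra.single m r) = AddMonoidAlgebra.single m.1 r :=
  AddMonoidAlgebra.mapDomain_single

instance (S : AddSubmonoid (Fin d → ℝ)) : IsDomain (AddMonoidAlgebra k S) :=
  (toGroupAlgebra_injective k S).isDomain

/-- The map `k[S] → k[T]` induced by an inclusion. -/
def inclusionHom {S T : AddSubmonoid (Fin d → ℝ)} (h : S ≤ T) :
    AddMonoidAlgebra k S →+* AddMonoidAlgebra k T :=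
  AddMonoidAlgebra.mapDomainRingHom k (AddSubmonoid.inclusion h)

@[simp] lemma inclusionHom_single {S T : AddSubmonoid (Fin d → ℝ)} (h : S ≤ T) (m : S) (r : k) :
    inclusionHom k h (AddMonoidAlgebra.single m r) =
      AddMonoidAlgebra.single ⟨m.1, h m.2⟩ r :=
  AddMonoidAlgebra.mapDomain_single

lemma toGroupAlgebra_inclusionHom {S T : AddSubmonoid (Fin d → ℝ)} (h : S ≤ T)
    (x : AddMonoidAlgebra k S) :
    toGroupAlgebra k T (inclusionHom k h x) = toGroupAlgebra k S x := by
  induction x using AddMonoidAlgebra.induction_linear with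
  | zero => simp
  | add x y hx hy => simp [hx, hy]
  | single m r => simp

lemma inclusionHom_injective {S T : AddSubmonoid (Fin d → ℝ)} (h : S ≤ T) :
    Function.Injective (inclusionHom k h) := fun x y hxy =>
  toGroupAlgebra_injective k S (by
    rw [← toGroupAlgebra_inclusionHom k h, hxy, toGroupAlgebra_inclusionHom])

/-- The projection of `k[ρ^∨ ∩ M]`, `ρ = ℝ_{≥0} w`, onto the span of the monomials of level zero,
viewed in the group algebra. -/
def faceHom (w : Fin d → ℤ) :
    AddMonoidAlgebra k (latticeMonoid 1 (ray w)) →+* AddMonoidAlgebra k (Fin d → ℝ) :=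
  open Classical in
  (AddMonoidAlgebra.lift k (AddMonoidAlgebra k (Fin d → ℝ)) (latticeMonoid 1 (ray w))
    { toFun := fun m => if m.toAdd.1 ⬝ᵥ latticeVec w = 0 then
        AddMonoidAlgebra.single m.toAdd.1 1 else 0
      map_one' := by simp [AddMonoidAlgebra.one_def]
      map_mul' := by
        -- Levels are nonnegative on `ρ^∨`, so a sum has level zero only if both summands do.
        intro m n
        have hm := mem_dualCone_ray.mp m.toAdd.2.1
        have hn := mem_dualCone_ray.mp n.toAdd.2.1
        simp only [toAdd_mul, AddSubmonoid.coe_add, add_dotProduct]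
        by_cases h1 : m.toAdd.1 ⬝ᵥ latticeVec w = 0
        · by_cases h2 : n.toAdd.1 ⬝ᵥ latticeVec w = 0
          · simp [h1, h2, AddMonoidAlgebra.single_mul_single]
          · simp [h1, h2]
        · have : m.toAdd.1 ⬝ᵥ latticeVec w + n.toAdd.1 ⬝ᵥ latticeVec w ≠ 0 := by
            have := lt_of_le_of_ne hm (Ne.symm h1)
            positivity
          simp [h1, this] }).toRingHom

open Classical in
lemma faceHom_single (w : Fin d → ℤ) (m : latticeMonoid 1 (ray w)) (r : k) :
    faceHom k w (AddMonoidAlgebra.single m r) =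
      if m.1 ⬝ᵥ latticeVec w = 0 then AddMonoidAlgebra.single m.1 r else 0 := by
  change AddMonoidAlgebra.lift _ _ _ _ _ = _
  rw [AddMonoidAlgebra.lift_single]
  simp

/-- The prime ideal of the toric divisor of `X_ρ`, `ρ = ℝ_{≥0} w`. -/
def divisorIdeal (w : Fin d → ℤ) : Ideal (AddMonoidAlgebra k (latticeMonoid 1 (ray w))) :=
  RingHom.ker (faceHom k w)

instance (w : Fin d → ℤ) : (divisorIdeal k w).IsPrime := RingHom.ker_isPrime _

/-- Modulo monomials of positive level, `f` equals its level-zero part, which `faceHom` determines.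
-/
lemma divisorIdeal_eq_span (w : Fin d → ℤ) : divisorIdeal k w = Ideal.span
    {x | ∃ m : latticeMonoid 1 (ray w), 0 < m.1 ⬝ᵥ latticeVec w ∧
      x = AddMonoidAlgebra.single m 1} := by
  set P := Ideal.span {x : AddMonoidAlgebra k (latticeMonoid 1 (ray w)) |
    ∃ m : latticeMonoid 1 (ray w), 0 < m.1 ⬝ᵥ latticeVec w ∧ x = AddMonoidAlgebra.single m 1}
  refine le_antisymm (fun f hf => ?_) (Ideal.span_le.mpr ?_)
  · have key : ∀ f, ∃ f₀, f - f₀ ∈ P ∧ toGroupAlgebra k _ f₀ = faceHom k w f := by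
      intro f
      induction f using AddMonoidAlgebra.induction_linear with
      | zero => exact ⟨0, by simp, by simp⟩
      | add x y hx hy =>
        obtain ⟨x₀, hx, hx'⟩ := hx
        obtain ⟨y₀, hy, hy'⟩ := hy
        exact ⟨x₀ + y₀, by rw [add_sub_add_comm]; exact add_mem hx hy, by simp [hx', hy']⟩
      | single m r =>
        by_cases hm : m.1 ⬝ᵥ latticeVec w = 0
        · exact ⟨.single m r, by simp, by simp [faceHom_single, hm]⟩
        · refine ⟨0, ?_, by simp [faceHom_single, hm]⟩
          have : (AddMonoidAlgebra.single m r : AddMonoidAlgebra k (latticeMonoid 1 (ray w))) =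
              .single 0 r * .single m 1 := by simp [AddMonoidAlgebra.single_mul_single]
          rw [sub_zero, this]
          exact Ideal.mul_mem_left _ _ (Ideal.subset_span
            ⟨m, lt_of_le_of_ne (mem_dualCone_ray.mp m.2.1) (Ne.symm hm), rfl⟩)
    obtain ⟨f₀, h, h'⟩ := key f
    rw [RingHom.mem_ker.mp hf, map_eq_zero_iff _ (toGroupAlgebra_injective k _)] at h'
    rwa [h', sub_zero] at h
  · rintro _ ⟨m, hm, rfl⟩
    change faceHom k w _ = 0
    simp [faceHom_single, hm.ne']

variable {k}

/-- The monomial `x^m` in `k[ρ^∨ ∩ M]`, `ρ = ℝ_{≥0} w`. -/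
def rayMonomial (k : Type u) [Field k] {w : Fin d → ℤ} (m : Fin d → ℤ) (hm : 0 ≤ m ⬝ᵥ w) :
    AddMonoidAlgebra k (latticeMonoid 1 (ray w)) :=
  .single ⟨latticeVec m, latticeVec_mem_latticeMonoid_ray.mpr hm⟩ 1

lemma rayMonomial_ne_zero {w : Fin d → ℤ} (m : Fin d → ℤ) (hm : 0 ≤ m ⬝ᵥ w) :
    rayMonomial k m hm ≠ 0 := by
  simp [rayMonomial]

lemma rayMonomial_mul {w : Fin d → ℤ} {m n : Fin d → ℤ} (hm : 0 ≤ m ⬝ᵥ w) (hn : 0 ≤ n ⬝ᵥ w) :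
    rayMonomial k m hm * rayMonomial k n hn =
      rayMonomial k (m + n) (by rw [add_dotProduct]; exact add_nonneg hm hn) := by
  rw [rayMonomial, rayMonomial, rayMonomial, AddMonoidAlgebra.single_mul_single, mul_one]
  congr 1
  exact Subtype.ext (latticeVec_add m n).symm

lemma rayMonomial_pow {w : Fin d → ℤ} {m : Fin d → ℤ} (hm : 0 ≤ m ⬝ᵥ w) (n : ℕ) :
    rayMonomial k m hm ^ n =
      rayMonomial k (n • m) (by rw [smul_dotProduct]; exact nsmul_nonneg hm n) := by
  rw [rayMonomial, rayMonomial, AddMonoidAlgebra.single_pow, one_pow]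
  congr 1
  exact Subtype.ext ((latticeVec_nsmul n m).trans (Nat.cast_smul_eq_nsmul ℝ n _)).symm

lemma rayMonomial_zero {w : Fin d → ℤ} (h : 0 ≤ (0 : Fin d → ℤ) ⬝ᵥ w) :
    rayMonomial k 0 h = 1 := by
  rw [rayMonomial, AddMonoidAlgebra.one_def]
  congr 1
  exact Subtype.ext latticeVec_zero

/-- Every scalar multiple of a monomial is `r x^m` with `m` in the lattice. -/
lemma single_eq_rayMonomial {w : Fin d → ℤ} (m : latticeMonoid 1 (ray w)) (r : k) :
    ∃ (n : Fin d → ℤ) (hn : 0 ≤ n ⬝ᵥ w), m.1 = latticeVec n ∧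
      (.single m r : AddMonoidAlgebra k (latticeMonoid 1 (ray w))) =
        .single 0 r * rayMonomial k n hn := by
  obtain ⟨n, hn⟩ := (mem_latticeMonoid_one.mp m.2).2
  have hn' : 0 ≤ n ⬝ᵥ w := latticeVec_mem_latticeMonoid_ray.mp (hn ▸ m.2)
  refine ⟨n, hn', hn, ?_⟩
  rw [rayMonomial, AddMonoidAlgebra.single_mul_single, mul_one, zero_add]
  congr 1
  exact Subtype.ext hn

/-- Membership in `ρ^∨ ∩ M` depends only on the level, and levels are integers: a monomial of
positive level stays in the ring after division by `x^a`. -/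
lemma divisorIdeal_eq_span_singleton {w a : Fin d → ℤ} (haw : a ⬝ᵥ w = 1) :
    divisorIdeal k w = Ideal.span {rayMonomial k a (w := w) (by omega)} := by
  rw [divisorIdeal_eq_span]
  refine le_antisymm (Ideal.span_le.mpr ?_) (Ideal.span_le.mpr (Set.singleton_subset_iff.mpr ?_))
  · rintro _ ⟨m, hm, rfl⟩
    obtain ⟨n, hn, hmn, h⟩ := single_eq_rayMonomial (k := k) m 1
    rw [hmn, latticeVec_dotProduct] at hm
    have hm' : 0 < n ⬝ᵥ w := by exact_mod_cast hm
    have hna : 0 ≤ (n - a) ⬝ᵥ w := by rw [sub_dotProduct, haw]; omega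
    rw [SetLike.mem_coe, Ideal.mem_span_singleton]
    refine ⟨rayMonomial k (n - a) hna, ?_⟩
    rw [rayMonomial_mul, h]
    simp only [add_sub_cancel]
    rw [← AddMonoidAlgebra.one_def, one_mul]
  · exact Ideal.subset_span ⟨_, by simp [latticeVec_dotProduct, haw], rfl⟩

/-- All exponents of a multiple of `x^(na)` have level at least `n`, which bounds `n` by the level
of any exponent in the support of `f`. -/
lemma finiteMultiplicity_rayMonomial {w a : Fin d → ℤ} (haw : a ⬝ᵥ w = 1)
    {f : AddMonoidAlgebra k (latticeMonoid 1 (ray w))} (hf : f ≠ 0) :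
    FiniteMultiplicity (rayMonomial k a (w := w) (by omega)) f := by
  obtain ⟨m, hm⟩ : ∃ m, f.coeff m ≠ 0 := by
    by_contra! h
    exact hf (AddMonoidAlgebra.ext (Finsupp.ext h))
  obtain ⟨n, hn⟩ := exists_nat_gt (m.1 ⬝ᵥ latticeVec w)
  refine ⟨n, fun ⟨g, hg⟩ => hm ?_⟩
  rw [hg, rayMonomial_pow, rayMonomial]
  refine AddMonoidAlgebra.coeff_single_mul_of_forall_add_ne _ _ fun q hq => ?_
  have h1 := congrArg (fun z => z.1 ⬝ᵥ latticeVec w) hq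
  have h2 := mem_dualCone_ray.mp q.2.1
  simp only [AddSubmonoid.coe_add, add_dotProduct, latticeVec_dotProduct, smul_dotProduct,
    haw] at h1
  simp at h1
  linarith

end MonoidAlgebra

lemma nonneg_of_mem_perpLattice {d : ℕ} {w b : Fin d → ℤ} (hb : b ∈ perpLattice w) :
    0 ≤ b ⬝ᵥ w := (mem_perpLattice.mp hb).ge

/-! ### The linear form attached to a class of exponents. -/

section MinimalForm

variable (k : Type u) [Field k] {d : ℕ} {σ : PointedCone ℝ (Fin d → ℝ)} {l : ℕ+}

open Classical in
/-- The `k`-linear map `k[σ^∨ ∩ (1/l)·M] → k[ρ^∨ ∩ M]` sending `x^m` to `x^(m - c)` if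
`m - c ∈ ρ^∨ ∩ M` and to zero otherwise. -/
def shiftForm (w : Fin d → ℤ) (σ : PointedCone ℝ (Fin d → ℝ)) (l : ℕ+) (c : Fin d → ℝ) :
    AddMonoidAlgebra k (latticeMonoid l σ) →ₗ[k] AddMonoidAlgebra k (latticeMonoid 1 (ray w)) :=
  (Finsupp.linearCombination k fun m : latticeMonoid l σ =>
    if h : m.1 - c ∈ latticeMonoid 1 (ray w) then
      (AddMonoidAlgebra.single ⟨m.1 - c, h⟩ 1 : AddMonoidAlgebra k (latticeMonoid 1 (ray w)))
    else 0) ∘ₗ (AddMonoidAlgebra.coeffLinearEquiv k).toLinearMap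

open Classical in
lemma shiftForm_single (w : Fin d → ℤ) (c : Fin d → ℝ) (m : latticeMonoid l σ) (r : k) :
    shiftForm k w σ l c (.single m r) = if h : m.1 - c ∈ latticeMonoid 1 (ray w) then
      .single ⟨m.1 - c, h⟩ r else 0 := by
  rw [shiftForm, LinearMap.comp_apply]
  have : (AddMonoidAlgebra.coeffLinearEquiv k).toLinearMap
      (.single m r : AddMonoidAlgebra k (latticeMonoid l σ)) = Finsupp.single m r := rfl
  rw [this, Finsupp.linearCombination_single]
  split_ifs with h
  · simp
  · simp

/-- If `c` has minimal level in its class, the form is linear over `k[σ^∨ ∩ M]`. -/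
lemma shiftForm_mul {w : Fin d → ℤ} (hw : latticeVec w ∈ σ) {c : Fin d → ℝ}
    (hc : ∀ m : Fin d → ℤ, m ⬝ᵥ w < 0 → c + latticeVec m ∉ dualCone σ)
    (s : AddMonoidAlgebra k (latticeMonoid 1 σ)) (t : AddMonoidAlgebra k (latticeMonoid l σ)) :
    shiftForm k w σ l c (inclusionHom k (latticeMonoid_one_le l σ) s * t) =
      inclusionHom k (latticeMonoid_anti 1 (ray_le hw)) s * shiftForm k w σ l c t := by
  induction s using AddMonoidAlgebra.induction_linear with
  | zero => simp
  | add x y hx hy => rw [map_add, add_mul, map_add, hx, hy, map_add, add_mul]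
  | single n r =>
    induction t using AddMonoidAlgebra.induction_linear with
    | zero => simp
    | add x y hx hy => rw [mul_add, map_add, hx, hy, map_add, mul_add]
    | single m q =>
      rw [inclusionHom_single, inclusionHom_single, AddMonoidAlgebra.single_mul_single,
        shiftForm_single, shiftForm_single]
      have hn : n.1 ∈ latticeMonoid 1 (ray w) := latticeMonoid_anti 1 (ray_le hw) n.2
      by_cases h : m.1 - c ∈ latticeMonoid 1 (ray w)
      · have h' : (n.1 + m.1) - c ∈ latticeMonoid 1 (ray w) := by
          rw [add_sub_assoc]
          exact add_mem hn h
        rw [dif_pos h, dif_pos (by exact h'), AddMonoidAlgebra.single_mul_single]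
        congr 1
        exact Subtype.ext (add_sub_assoc n.1 m.1 c)
      -- If `n + m - c` is a lattice point, then `m ∈ c + M`; minimality of `c` makes `m - c` of
      -- nonnegative level, contrary to `h`.
      · have h' : (n.1 + m.1) - c ∉ latticeMonoid 1 (ray w) := by
          intro h'
          obtain ⟨p, hp⟩ := (mem_latticeMonoid_one.mp h').2
          obtain ⟨n', hn'⟩ := (mem_latticeMonoid_one.mp n.2).2
          have hm : m.1 = c + latticeVec (p - n') := by
            rw [latticeVec_sub, ← hp, ← hn']
            abel
          have h0 : 0 ≤ (p - n') ⬝ᵥ w := by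
            by_contra hlt
            exact hc _ (not_le.mp hlt) (hm ▸ m.2.1)
          exact h (by rw [hm, add_sub_cancel_left]; exact latticeVec_mem_latticeMonoid_ray.mpr h0)
        rw [dif_neg h, dif_neg (by exact h'), mul_zero]

end MinimalForm

/-- The local ring of the toric divisor is a discrete valuation ring. -/
lemma isDiscreteValuationRing_of_level_one (k : Type u) [Field k] {d : ℕ} {w a : Fin d → ℤ}
    (haw : a ⬝ᵥ w = 1) (O : Type*) [CommRing O] [IsDomain O]
    [Algebra (AddMonoidAlgebra k (latticeMonoid 1 (ray w))) O]
    [IsLocalization.AtPrime O (divisorIdeal k w)] : IsDiscreteValuationRing O :=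
  isDiscreteValuationRing_of_isLocalization_span_singleton (P := divisorIdeal k w)
    (divisorIdeal_eq_span_singleton haw) (rayMonomial_ne_zero _ _)
    fun _ hf => finiteMultiplicity_rayMonomial haw hf

/-! ### Generating the local ring of the divisor, and the consequence of flatness. -/

section LocalRing

variable {k : Type u} [Field k] {d : ℕ} {σ : PointedCone ℝ (Fin d → ℝ)} {w a : Fin d → ℤ}
  {O : Type*} [CommRing O] [Algebra (AddMonoidAlgebra k (latticeMonoid 1 (ray w))) O]
  [IsLocalization.AtPrime O (divisorIdeal k w)]

variable (k w O)

lemma algebraMap_localization_injective :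
    Function.Injective (algebraMap (AddMonoidAlgebra k (latticeMonoid 1 (ray w))) O) :=
  IsLocalization.injective O (divisorIdeal k w).primeCompl_le_nonZeroDivisors

/-- The local ring of the toric divisor embeds in the fraction field of the group algebra. -/
lemma exists_ringHom_fractionRing : ∃ i : O →+* FractionRing (AddMonoidAlgebra k (Fin d → ℝ)),
    ∀ x, i (algebraMap (AddMonoidAlgebra k (latticeMonoid 1 (ray w))) O x) =
      algebraMap _ _ (toGroupAlgebra k _ x) := by
  let g : AddMonoidAlgebra k (latticeMonoid 1 (ray w)) →+*
      FractionRing (AddMonoidAlgebra k (Fin d → ℝ)) := (algebraMap _ _).comp (toGroupAlgebra k _)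
  have hg : Function.Injective g :=
    (IsFractionRing.injective _ _).comp (toGroupAlgebra_injective k _)
  refine ⟨IsLocalization.lift (M := (divisorIdeal k w).primeCompl) (g := g) fun y => ?_,
    fun x => IsLocalization.lift_eq _ _⟩
  refine IsUnit.mk0 _ ?_
  rw [Ne, map_eq_zero_iff g hg]
  rintro h
  exact y.2 (h ▸ zero_mem _)

variable {k w O}

/-- Multiplication by a high power of `x^a` moves any element into `k[σ^∨ ∩ M]`. -/
lemma exists_inclusionHom_eq (hw : latticeVec w ∈ σ)
    (ha : latticeVec a ∈ interior (dualCone σ : Set (Fin d → ℝ))) (ha0 : 0 ≤ a ⬝ᵥ w)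
    (f : AddMonoidAlgebra k (latticeMonoid 1 (ray w))) :
    ∃ N : ℕ, ∀ n : ℕ, N ≤ n → ∃ s : AddMonoidAlgebra k (latticeMonoid 1 σ),
      inclusionHom k (latticeMonoid_anti 1 (ray_le hw)) s = rayMonomial k a ha0 ^ n * f := by
  induction f using AddMonoidAlgebra.induction_linear with
  | zero => exact ⟨0, fun n _ => ⟨0, by simp⟩⟩
  | add x y hx hy =>
    obtain ⟨N₁, h₁⟩ := hx
    obtain ⟨N₂, h₂⟩ := hy
    refine ⟨max N₁ N₂, fun n hn => ?_⟩
    obtain ⟨s₁, hs₁⟩ := h₁ n (le_of_max_le_left hn)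
    obtain ⟨s₂, hs₂⟩ := h₂ n (le_of_max_le_right hn)
    exact ⟨s₁ + s₂, by rw [map_add, hs₁, hs₂, mul_add]⟩
  | single m r =>
    obtain ⟨N, hN⟩ := exists_nat_add_smul_mem_interior ha m.1
    refine ⟨N, fun n hn => ?_⟩
    obtain ⟨p, hp, hmp, h⟩ := single_eq_rayMonomial (k := k) m r
    have hmem : latticeVec (n • a + p) ∈ latticeMonoid 1 σ := by
      rw [latticeVec_mem_latticeMonoid_one, latticeVec_add, latticeVec_nsmul, add_comm, ← hmp]
      exact interior_subset (hN n hn)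
    refine ⟨.single ⟨_, hmem⟩ r, ?_⟩
    rw [h, rayMonomial_pow, mul_left_comm, rayMonomial_mul, inclusionHom_single, rayMonomial,
      AddMonoidAlgebra.single_mul_single, zero_add, mul_one]

/-- Every element of the local ring of the toric divisor is a fraction of elements of
`k[σ^∨ ∩ M]`. -/
lemma exists_mul_eq_of_localization (hw : latticeVec w ∈ σ)
    (ha : latticeVec a ∈ interior (dualCone σ : Set (Fin d → ℝ))) (ha0 : 0 ≤ a ⬝ᵥ w) (z : O) :
    ∃ s s' : AddMonoidAlgebra k (latticeMonoid 1 σ),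
      algebraMap (AddMonoidAlgebra k (latticeMonoid 1 (ray w))) O
        (inclusionHom k (latticeMonoid_anti 1 (ray_le hw)) s) ≠ 0 ∧
      algebraMap (AddMonoidAlgebra k (latticeMonoid 1 (ray w))) O
        (inclusionHom k (latticeMonoid_anti 1 (ray_le hw)) s) * z =
      algebraMap (AddMonoidAlgebra k (latticeMonoid 1 (ray w))) O
        (inclusionHom k (latticeMonoid_anti 1 (ray_le hw)) s') := by
  obtain ⟨⟨f, g⟩, hfg⟩ := IsLocalization.surj (divisorIdeal k w).primeCompl z
  obtain ⟨N₁, h₁⟩ := exists_inclusionHom_eq hw ha ha0 g.1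
  obtain ⟨N₂, h₂⟩ := exists_inclusionHom_eq hw ha ha0 f
  obtain ⟨s, hs⟩ := h₁ (max N₁ N₂) (le_max_left _ _)
  obtain ⟨s', hs'⟩ := h₂ (max N₁ N₂) (le_max_right _ _)
  have hg : g.1 ≠ 0 := fun h => g.2 (h ▸ zero_mem _)
  refine ⟨s, s', ?_, ?_⟩
  · rw [hs, Ne, map_eq_zero_iff _ (algebraMap_localization_injective k w O)]
    exact mul_ne_zero (pow_ne_zero _ (rayMonomial_ne_zero _ _)) hg
  · rw [hs, hs', map_mul, map_mul, mul_assoc, mul_comm _ z]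
    exact congrArg _ hfg

/-- A local homomorphism to the local ring of the toric divisor is surjective if its range contains
`k[σ^∨ ∩ M]` and the monomials of a generating set of `w^⊥ ∩ M`. -/
theorem surjective_of_isLocalHom {Q : Type*} [CommRing Q] (hw : latticeVec w ∈ σ)
    (ha : latticeVec a ∈ interior (dualCone σ : Set (Fin d → ℝ))) (haw : a ⬝ᵥ w = 1)
    (g : Q →+* O) [IsLocalHom g]
    (hS : ∀ s : AddMonoidAlgebra k (latticeMonoid 1 σ),
      algebraMap (AddMonoidAlgebra k (latticeMonoid 1 (ray w))) O
        (inclusionHom k (latticeMonoid_anti 1 (ray_le hw)) s) ∈ g.range)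
    {G : Set (Fin d → ℤ)} (hG : perpLattice w ≤ AddSubgroup.closure G)
    (hGw : G ⊆ perpLattice w)
    (hGr : ∀ b, ∀ hb : b ∈ G,
      algebraMap _ O (rayMonomial k b (nonneg_of_mem_perpLattice (hGw hb))) ∈ g.range) :
    Function.Surjective g := by
  have hGle : AddSubgroup.closure G ≤ perpLattice w := (AddSubgroup.closure_le _).mpr hGw
  have hperp : ∀ b (hb : b ∈ AddSubgroup.closure G),
      algebraMap _ O (rayMonomial k b (nonneg_of_mem_perpLattice (hGle hb))) ∈ g.range := by
    intro b hb
    induction hb using AddSubgroup.closure_induction with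
    | mem b hb => exact hGr b hb
    | zero => rw [rayMonomial_zero, map_one]; exact one_mem _
    | add b c hb hc h h' =>
      rw [← rayMonomial_mul (nonneg_of_mem_perpLattice (hGle hb))
        (nonneg_of_mem_perpLattice (hGle hc)), map_mul]
      exact mul_mem h h'
    | neg b hb h =>
      obtain ⟨r, hr⟩ := h
      have hneg : (-b) ⬝ᵥ w = 0 := by
        rw [neg_dotProduct, mem_perpLattice.mp (hGle hb), neg_zero]
      have hmul : algebraMap _ O (rayMonomial k b (nonneg_of_mem_perpLattice (hGle hb))) *
          algebraMap _ O (rayMonomial k (-b) hneg.ge) = 1 := by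
        rw [← map_mul, rayMonomial_mul]
        simp only [add_neg_cancel]
        rw [rayMonomial_zero, map_one]
      -- As `x^b` is a unit of `O` and `g` is local, its preimage is a unit, whose inverse maps to
      -- `x^(-b)`.
      have hunit : IsUnit (g r) := hr ▸ IsUnit.of_mul_eq_one _ hmul
      obtain ⟨u, rfl⟩ := isUnit_of_map_unit g r hunit
      refine ⟨(u⁻¹ : Qˣ), ?_⟩
      have h1 : g u * g (u⁻¹ : Qˣ) = 1 := by rw [← map_mul, Units.mul_inv, map_one]
      rw [hr] at h1
      exact hunit.mul_left_cancel (by rw [hr, h1, hmul])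
  have hA : ∀ f, algebraMap (AddMonoidAlgebra k (latticeMonoid 1 (ray w))) O f ∈ g.range := by
    intro f
    induction f using AddMonoidAlgebra.induction_linear with
    | zero => simp
    | add x y hx hy => rw [map_add]; exact add_mem hx hy
    | single m r =>
      obtain ⟨p, hp, hmp, h⟩ := single_eq_rayMonomial (k := k) m r
      -- Level one of `a` splits every exponent as a multiple of `a` plus an element of `w^⊥ ∩ M`.
      have hb : p - (p ⬝ᵥ w).toNat • a ∈ perpLattice w := by
        rw [mem_perpLattice, sub_dotProduct, smul_dotProduct, haw]
        simp [Int.toNat_of_nonneg hp]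
      have ha' : latticeVec a ∈ latticeMonoid 1 σ :=
        latticeVec_mem_latticeMonoid_one.mpr (interior_subset ha)
      have hpe : rayMonomial k p hp = rayMonomial k _ (nonneg_of_mem_perpLattice (hGle (hG hb))) *
          rayMonomial k a (w := w) (by omega) ^ (p ⬝ᵥ w).toNat := by
        rw [rayMonomial_pow, rayMonomial_mul]
        simp
      rw [h, hpe, map_mul, map_mul, map_pow]
      refine mul_mem ?_ (mul_mem (hperp _ (hG hb)) (pow_mem ?_ _))
      · have := hS (.single 0 r)
        rwa [inclusionHom_single] at this
      · have := hS (.single ⟨_, ha'⟩ 1)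
        rwa [inclusionHom_single] at this
  intro z
  obtain ⟨⟨f, s⟩, hfs⟩ := IsLocalization.surj (divisorIdeal k w).primeCompl z
  obtain ⟨q, hq⟩ := hA f
  obtain ⟨r, hr⟩ := hA s.1
  have hs : IsUnit (algebraMap _ O s.1) := IsLocalization.map_units O s
  obtain ⟨u, rfl⟩ := isUnit_of_map_unit g r (hr ▸ hs)
  refine ⟨q * (u⁻¹ : Qˣ), ?_⟩
  have h1 : g u * g (u⁻¹ : Qˣ) = 1 := by rw [← map_mul, Units.mul_inv, map_one]
  change z * algebraMap _ O s.1 = algebraMap _ O f at hfs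
  rw [map_mul, hq, ← hfs, ← hr, mul_assoc, h1, mul_one]

/-- Flatness forces the monomial of a translation between minimal points into the local ring. -/
theorem exists_isUnit_mul_rayMonomial [IsDomain O] [IsLocalRing O] {l : ℕ+} (hw : latticeVec w ∈ σ)
    (ha : latticeVec a ∈ interior (dualCone σ : Set (Fin d → ℝ))) (haw : a ⬝ᵥ w = 1)
    {R P B : Type*} [CommRing R] [CommRing P] [CommRing B]
    (ρ : AddMonoidAlgebra k (latticeMonoid 1 σ) →+* R) (φ : R →+* O)
    (hρφ : ∀ s, φ (ρ s) = algebraMap (AddMonoidAlgebra k (latticeMonoid 1 (ray w))) O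
      (inclusionHom k (latticeMonoid_anti 1 (ray_le hw)) s))
    (hφ : Function.Injective φ)
    (i : R →+* P) (j : AddMonoidAlgebra k (latticeMonoid l σ) →+* P)
    (hij : i.comp ρ = j.comp (inclusionHom k (latticeMonoid_one_le l σ)))
    (hpush : letI := ρ.toAlgebra; letI := (inclusionHom k (latticeMonoid_one_le l σ)).toAlgebra
      letI := i.toAlgebra; letI := j.toAlgebra; letI := (i.comp ρ).toAlgebra
      haveI : IsScalarTower (AddMonoidAlgebra k (latticeMonoid 1 σ)) R P := .of_algebraMap_eq' rfl
      haveI : IsScalarTower (AddMonoidAlgebra k (latticeMonoid 1 σ))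
        (AddMonoidAlgebra k (latticeMonoid l σ)) P := .of_algebraMap_eq' hij
      Algebra.IsPushout (AddMonoidAlgebra k (latticeMonoid 1 σ)) R
        (AddMonoidAlgebra k (latticeMonoid l σ)) P)
    (q : P →+* B) (hflat : (q.comp i).Flat) (hq : Function.Surjective q)
    (hker : ∀ x, q x = 0 → IsNilpotent x)
    {b : Fin d → ℤ} (hb : b ∈ perpLattice w) {c : Fin d → ℝ} (hc : c ∈ latticeMonoid l σ)
    (hmin : IsMinimalPair σ w b c) :
    ∃ r r' : R, IsUnit (φ r) ∧
      algebraMap _ O (rayMonomial k b (nonneg_of_mem_perpLattice hb)) * φ r = φ r' := by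
  algebraize_only [ρ, inclusionHom k (latticeMonoid_one_le l σ), i, j, i.comp ρ, φ, q.comp i]
  have h1 : IsScalarTower (AddMonoidAlgebra k (latticeMonoid 1 σ)) R P := .of_algebraMap_eq' rfl
  have h2 : IsScalarTower (AddMonoidAlgebra k (latticeMonoid 1 σ))
    (AddMonoidAlgebra k (latticeMonoid l σ)) P := .of_algebraMap_eq' hij
  have hpush' : Algebra.IsPushout (AddMonoidAlgebra k (latticeMonoid 1 σ)) R
        (AddMonoidAlgebra k (latticeMonoid l σ)) P := hpush
  let : Algebra (AddMonoidAlgebra k (latticeMonoid 1 σ)) O := (φ.comp ρ).toAlgebra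
  have h3 : IsScalarTower (AddMonoidAlgebra k (latticeMonoid 1 σ)) R O := .of_algebraMap_eq' rfl
  have hflat' : Module.Flat R B := hflat
  have haw0 : 0 ≤ a ⬝ᵥ w := by omega
  obtain ⟨iO, hiO⟩ := exists_ringHom_fractionRing k w O
  let q' : P →ₐ[R] B := { q with commutes' := fun r => rfl }
  let θ : AddMonoidAlgebra k (latticeMonoid l σ) →ₗ[AddMonoidAlgebra k (latticeMonoid 1 σ)] O :=
    { toFun := fun t => algebraMap _ O (shiftForm k w σ l c t)
      map_add' := fun x y => by rw [map_add, map_add]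
      map_smul' := fun s t => by
        have e : s • t = inclusionHom k (latticeMonoid_one_le l σ) s * t := rfl
        have e' : ∀ z : O, s • z = φ (ρ s) * z := fun z => rfl
        rw [RingHom.id_apply, e, e', shiftForm_mul k hw hmin.2.2, map_mul, hρφ] }
  -- Since `b` itself need not lie in `σ^∨`, it is written as the difference of `na + b` and `na`,
  -- both in `σ^∨ ∩ M`.
  obtain ⟨n, hn⟩ := exists_nat_add_smul_mem_interior ha (latticeVec b)
  have hna : latticeVec (n • a) ∈ latticeMonoid 1 σ := by
    rw [latticeVec_mem_latticeMonoid_one, latticeVec_nsmul]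
    exact smul_mem_dualCone (interior_subset ha) (Nat.cast_nonneg n)
  have hnab : latticeVec (n • a + b) ∈ latticeMonoid 1 σ := by
    rw [latticeVec_mem_latticeMonoid_one, latticeVec_add, latticeVec_nsmul, add_comm]
    exact interior_subset (hn n le_rfl)
  have hcb : c + latticeVec b ∈ latticeMonoid l σ := by
    obtain ⟨m, hm⟩ := hc.2
    refine ⟨hmin.2.1, m + (l : ℕ) • b, ?_⟩
    rw [smul_add, hm, latticeVec_add, latticeVec_nsmul]
  obtain ⟨r, r', hr, hrr'⟩ := exists_isUnit_of_flat (S := AddMonoidAlgebra k (latticeMonoid 1 σ))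
    (T := AddMonoidAlgebra k (latticeMonoid l σ)) (R := R) (P := P) (B := B) (O := O) hφ
    (fun z => by
      obtain ⟨s, s', hs, hs'⟩ := exists_mul_eq_of_localization (k := k) hw ha haw0 z
      rw [← hρφ] at hs
      rw [← hρφ, ← hρφ] at hs'
      exact ⟨s, s', hs, hs'⟩) iO
    ((algebraMap _ (FractionRing (AddMonoidAlgebra k (Fin d → ℝ)))).comp (toGroupAlgebra k _))
    ((IsFractionRing.injective _ _).comp (toGroupAlgebra_injective k _))
    (fun s => by
      change iO (φ (ρ s)) = algebraMap _ _ (toGroupAlgebra k _ (inclusionHom k _ s))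
      rw [hρφ, hiO, toGroupAlgebra_inclusionHom, toGroupAlgebra_inclusionHom])
    q' hq hker θ (t := .single ⟨c, hc⟩ 1) (t' := .single ⟨_, hcb⟩ 1)
    (by
      change IsUnit (algebraMap _ O (shiftForm k w σ l c _))
      have h0 : c - c ∈ latticeMonoid 1 (ray w) := by rw [sub_self]; exact zero_mem _
      rw [shiftForm_single, dif_pos h0]
      have : (AddMonoidAlgebra.single ⟨c - c, h0⟩ 1 :
          AddMonoidAlgebra k (latticeMonoid 1 (ray w))) = 1 := by
        rw [AddMonoidAlgebra.one_def]
        congr 1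
        exact Subtype.ext (sub_self c)
      rw [this, map_one]
      exact isUnit_one)
    (p := .single ⟨_, hna⟩ 1) (p' := .single ⟨_, hnab⟩ 1)
    (by
      change inclusionHom k (latticeMonoid_one_le l σ) _ * _ =
        inclusionHom k (latticeMonoid_one_le l σ) _ * _
      rw [inclusionHom_single, inclusionHom_single, AddMonoidAlgebra.single_mul_single,
        AddMonoidAlgebra.single_mul_single]
      congr 1
      refine Subtype.ext ?_
      change latticeVec (n • a + b) + c = latticeVec (n • a) + (c + latticeVec b)
      rw [latticeVec_add]
      abel)
  refine ⟨r, r', hr, ?_⟩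
  change φ (ρ _) * φ r = φ (ρ _) * φ r' at hrr'
  rw [hρφ, hρφ, inclusionHom_single, inclusionHom_single] at hrr'
  have hnab0 : 0 ≤ (n • a + b) ⬝ᵥ w := by
    rw [add_dotProduct, mem_perpLattice.mp hb, add_zero, smul_dotProduct]
    exact nsmul_nonneg haw0 n
  have hna0 : 0 ≤ (n • a) ⬝ᵥ w := by rw [smul_dotProduct]; exact nsmul_nonneg haw0 n
  change algebraMap _ O (rayMonomial k (n • a + b) hnab0) * φ r =
    algebraMap _ O (rayMonomial k (n • a) hna0) * φ r' at hrr'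
  rw [← rayMonomial_mul hna0 (nonneg_of_mem_perpLattice hb), map_mul, mul_assoc] at hrr'
  refine mul_left_cancel₀ ?_ hrr'
  rw [Ne, map_eq_zero_iff _ (algebraMap_localization_injective k w O)]
  exact rayMonomial_ne_zero _ _

end LocalRing

/-! ### Scheme-theoretic input -/

section Schemes

lemma le_preimage_top {X Y : Scheme.{u}} (f : Y ⟶ X) (U : Y.Opens) : U ≤ f ⁻¹ᵁ ⊤ := le_top

/-- Over an affine open `U` of `Y`, the flat reduced fibre product with an affine morphism
`Spec T ⟶ Spec S` is the spectrum of a flat quotient of `Γ(Y, U) ⊗_S T` by a nil ideal. -/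
theorem exists_flat_quotient_isPushout {S T : CommRingCat.{u}} (α : S ⟶ T) {Y : Scheme.{u}}
    (f : Y ⟶ Spec S) (hf : Flat ((pullback f (Spec.map α)).nilradical.subschemeι ≫
      pullback.fst f (Spec.map α))) {U : Y.Opens} (hU : IsAffineOpen U) :
    ∃ (P B : CommRingCat.{u}) (i : Γ(Y, U) ⟶ P) (j : T ⟶ P) (q : P ⟶ B),
      IsPushout ((Scheme.ΓSpecIso S).inv ≫ f.appLE ⊤ U (le_preimage_top f U)) α i j ∧
      (i ≫ q).hom.Flat ∧ Function.Surjective q ∧ ∀ x, q x = 0 → IsNilpotent x := by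
  let g := Spec.map α
  have : IsAffineHom g := inferInstanceAs (IsAffineHom (Spec.map α))
  have : IsAffineHom (pullback.fst f g) :=
    MorphismProperty.of_isPullback (P := @IsAffineHom) (IsPullback.of_hasPullback f g).flip this
  let V : (pullback f g).Opens := pullback.fst f g ⁻¹ᵁ U
  have hV : IsAffineOpen V := hU.preimage _
  have hV' : V = pullback.fst f g ⁻¹ᵁ U ⊓ pullback.snd f g ⁻¹ᵁ ⊤ := by simp [V]
  let N := (pullback f g).nilradical
  have hpush := (isIso_pushoutSection_iff (IsPullback.of_hasPullback f g).flip
    (US := ⊤) (UT := U) (UX := ⊤) (le_preimage_top _ _) (le_preimage_top _ _) (UY := V)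
    (by rw [hV', inf_comm])).mp
    (isIso_pushoutSection_of_isAffineOpen _ _ _ _ (isAffineOpen_top _) hU (isAffineOpen_top _))
  refine ⟨Γ(pullback f g, V), Γ(N.subscheme, N.subschemeι ⁻¹ᵁ V),
    (pullback.fst f g).appLE U V le_rfl,
    (Scheme.ΓSpecIso T).inv ≫ (pullback.snd f g).appLE ⊤ V (le_preimage_top _ _),
    N.subschemeι.app V,
    ?_, ?_, ?_, ?_⟩
  · refine IsPushout.of_iso hpush.flip (Scheme.ΓSpecIso S) (Iso.refl _) (Scheme.ΓSpecIso T)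
      (Iso.refl _) ?_ ?_ ?_ ?_
    · simp
    · rw [← Scheme.ΓSpecIso_naturality, Scheme.Hom.appTop, Scheme.Hom.app_eq_appLE]
      rfl
    · simp
    · simp
  · have := Scheme.Hom.flat_appLE (N.subschemeι ≫ pullback.fst f g) hU
      (hV.preimage N.subschemeι) le_rfl
    rw [Scheme.Hom.app_eq_appLE, Scheme.Hom.appLE_comp_appLE]
    exact this
  · exact N.subschemeι_app_surjective ⟨V, hV⟩
  · intro x hx
    have : x ∈ RingHom.ker (N.subschemeι.app V).hom := hx
    rw [N.ker_subschemeι_app ⟨V, hV⟩] at this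
    exact this

/-- A field-valued point at the generic point lifts along a birational morphism. -/
theorem exists_generic_lift {X Y : Scheme.{u}} [IsIntegral X] [IsIntegral Y]
    {f : Y ⟶ X} (hf : Scheme.BirationalOver f (𝟙 X)) {K : Type u} [Field K]
    (κ : Spec (.of K) ⟶ X) (hκ : ∀ x, κ x = genericPoint X) :
    ∃ η : Spec (.of K) ⟶ Y, η ≫ f = κ ∧ ∀ x, η x = genericPoint Y := by
  obtain ⟨p, hp⟩ := hf
  rw [Scheme.PartialIso.IsOver, Category.comp_id] at hp
  have : Nonempty p.source := p.dense_source.nonempty.to_subtype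
  have : Nonempty p.target := p.dense_target.nonempty.to_subtype
  have : IsIntegral p.source := isIntegral_of_isOpenImmersion p.source.ι
  have : IsIntegral p.target := isIntegral_of_isOpenImmersion p.target.ι
  have hX : p.target.ι (genericPoint p.target) = genericPoint X :=
    genericPoint_eq_of_isOpenImmersion _
  have hY : p.source.ι (genericPoint p.source) = genericPoint Y :=
    genericPoint_eq_of_isOpenImmersion _
  have hi : p.iso.inv (genericPoint p.target) = genericPoint p.source :=
    genericPoint_eq_of_isOpenImmersion _
  have hrange : Set.range κ ⊆ Set.range p.target.ι := by
    rintro _ ⟨x, rfl⟩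
    exact ⟨_, hX.trans (hκ x).symm⟩
  refine ⟨IsOpenImmersion.lift p.target.ι κ hrange ≫ p.iso.inv ≫ p.source.ι, ?_, fun x => ?_⟩
  · rw [Category.assoc, Category.assoc, ← hp, Iso.inv_hom_id_assoc, IsOpenImmersion.lift_fac]
  · have h1 : (IsOpenImmersion.lift p.target.ι κ hrange) x = genericPoint p.target := by
      refine p.target.ι.isOpenEmbedding.injective ?_
      rw [hX, ← hκ x, ← Scheme.Hom.comp_apply, IsOpenImmersion.lift_fac]
    rw [Scheme.Hom.comp_apply, Scheme.Hom.comp_apply, h1, hi, hY]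

/-- A dominant morphism from the spectrum of a local domain is injective on the local ring. -/
theorem stalkClosedPointTo_injective {Z : Scheme.{u}} [IsIntegral Z] {O : Type u} [CommRing O]
    [IsLocalRing O] (t : Spec (.of O) ⟶ Z) (x : Spec (.of O))
    (ht : t x = genericPoint Z) : Function.Injective (Scheme.stalkClosedPointTo t) := by
  let z := t (IsLocalRing.closedPoint O)
  let ψ : Z.presheaf.stalk z ⟶ .of O := Scheme.stalkClosedPointTo t
  let b : Spec (Z.presheaf.stalk z) := (⟨⊥, Ideal.isPrime_bot⟩ : PrimeSpectrum _)
  have h1 : Z.fromSpecStalk z (Spec.map ψ x) = genericPoint Z := by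
    rw [← Scheme.Hom.comp_apply, Scheme.Spec_stalkClosedPointTo_fromSpecStalk, ht]
  -- The image of `x` in the spectrum of the stalk lies over the generic point, hence is the zero
  -- ideal; it contains the kernel of `ψ`.
  have h2 : Spec.map ψ x ⤳ b := by
    rw [← (Z.fromSpecStalk z).isEmbedding.isInducing.specializes_iff, h1]
    exact genericPoint_specializes _
  have h3 : (Spec.map ψ x).asIdeal ≤ b.asIdeal := (PrimeSpectrum.le_iff_specializes _ _).mpr h2
  refine (injective_iff_map_eq_zero ψ.hom).mpr fun s hs => ?_
  refine h3 (show ψ.hom s ∈ x.asIdeal from ?_)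
  rw [hs]
  exact zero_mem _

/-- A local morphism compatible with the structure over an affine scheme, on sections. -/
lemma appLE_germ_stalkClosedPointTo {S : CommRingCat.{u}} {Y : Scheme.{u}} (f : Y ⟶ Spec S)
    {O : Type u} [CommRing O] [IsLocalRing O] (t : Spec (.of O) ⟶ Y) (β : S ⟶ .of O)
    (h : t ≫ f = Spec.map β) (U : Y.Opens) (hU : t (IsLocalRing.closedPoint O) ∈ U) :
    (Scheme.ΓSpecIso S).inv ≫ f.appLE ⊤ U (le_preimage_top f U) ≫ Y.presheaf.germ U _ hU ≫
      Scheme.stalkClosedPointTo t = β := by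
  have e := Scheme.preimage_eq_top_of_closedPoint_mem t hU
  rw [Scheme.germ_stalkClosedPointTo, Iso.trans_hom, Scheme.Hom.app_eq_appLE]
  have h1 : f.appLE ⊤ U (le_preimage_top f U) ≫ t.appLE U ⊤ e.ge = (Spec.map β).appTop := by
    rw [Scheme.Hom.appLE_comp_appLE, Scheme.Hom.appTop, Scheme.Hom.app_eq_appLE]
    congr 1
  simp only [Functor.mapIso_hom, Iso.op_hom, eqToIso.hom]
  rw [Scheme.Hom.appLE_map_assoc]
  rw [← Category.assoc (f.appLE _ _ _), h1, Scheme.ΓSpecIso_naturality, Iso.inv_hom_id_assoc]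

end Schemes

/-! ### The local ring of the divisor on the flattening and its normalization. -/

section Divisor

variable (k : Type u) [Field k] {d : ℕ} {σ : PointedCone ℝ (Fin d → ℝ)}

/-- The generic point of the toric divisor of `X_ρ`, `ρ = ℝ_{≥0} w`. -/
def divisorPoint (w : Fin d → ℤ) :
    Spec (CommRingCat.of (AddMonoidAlgebra k (latticeMonoid 1 (ray w)))) :=
  (⟨divisorIdeal k w, inferInstance⟩ : PrimeSpectrum (AddMonoidAlgebra k (latticeMonoid 1 (ray w))))

/-- The local ring of the toric divisor. -/
abbrev DivisorRing (w : Fin d → ℤ) : Type u :=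
  (Spec (CommRingCat.of (AddMonoidAlgebra k (latticeMonoid 1 (ray w))))).presheaf.stalk
    (divisorPoint k w)

instance (w : Fin d → ℤ) :
    Algebra (AddMonoidAlgebra k (latticeMonoid 1 (ray w))) (DivisorRing k w) :=
  (StructureSheaf.toStalk (AddMonoidAlgebra k (latticeMonoid 1 (ray w)))
    (divisorPoint k w)).hom.toAlgebra

instance (w : Fin d → ℤ) :
    IsLocalization.AtPrime (DivisorRing k w) (divisorIdeal k w) :=
  StructureSheaf.IsLocalization.to_stalk _ (divisorPoint k w)

lemma isGenericPoint_divisorPoint (w : Fin d → ℤ) :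
    IsGenericPoint (divisorPoint k w : toricVariety k (ray w)) (toricDivisor k w) := by
  have h : toricDivisor k w = PrimeSpectrum.zeroLocus (divisorIdeal k w) := by
    rw [divisorIdeal_eq_span, PrimeSpectrum.zeroLocus_span]
    rfl
  rw [h]
  exact PrimeSpectrum.closure_singleton _

/-- The map `k[σ^∨ ∩ M] → 𝒪` to the local ring of the toric divisor. -/
def toDivisorRing {w : Fin d → ℤ} (hw : latticeVec w ∈ σ) :
    AddMonoidAlgebra k (latticeMonoid 1 σ) →+* DivisorRing k w :=
  (algebraMap _ (DivisorRing k w)).comp (inclusionHom k (latticeMonoid_anti 1 (ray_le hw)))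

lemma fromSpecStalk_divisorPoint {w : Fin d → ℤ} (hw : latticeVec w ∈ σ) :
    (toricVariety k (ray w)).fromSpecStalk (divisorPoint k w) ≫ toricMap k (ray_le hw) =
      Spec.map (CommRingCat.ofHom (toDivisorRing k hw)) := by
  exact (congrArg (· ≫ toricMap k (ray_le hw)) (Spec.fromSpecStalk_eq' _ _)).trans
    (Spec.map_comp _ _).symm

lemma toDivisorRing_injective {w : Fin d → ℤ} (hw : latticeVec w ∈ σ) :
    Function.Injective (toDivisorRing k hw) :=
  (algebraMap_localization_injective k w (DivisorRing k w)).comp (inclusionHom_injective k _)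

instance (σ : PointedCone ℝ (Fin d → ℝ)) : IsIntegral (toricVariety k σ) :=
  inferInstanceAs (IsIntegral (Spec (CommRingCat.of (AddMonoidAlgebra k (latticeMonoid 1 σ)))))

variable {w a : Fin d → ℤ} {l : ℕ+}

/-- The local ring of `w` is dominated by that of a point of `Z`, and it receives a lift. -/
theorem exists_lift_divisorRing (hw : latticeVec w ∈ σ) (haw : a ⬝ᵥ w = 1)
    {Y Z : Scheme.{u}} (f : Y ⟶ toricVariety k σ) (ν : Z ⟶ Y) [IsIntegral Y] [IsIntegral Z]
    [UniversallyClosed f] [UniversallyClosed ν]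
    (hf : Scheme.BirationalOver f (𝟙 _)) (hν : Scheme.BirationalOver ν (𝟙 Y)) :
    ∃ t : Spec (CommRingCat.of (DivisorRing k w)) ⟶ Z,
      t ≫ ν ≫ f = Spec.map (CommRingCat.ofHom (toDivisorRing k hw)) ∧
      ∃ x, t x = genericPoint Z ∧ (t ≫ ν) x = genericPoint Y := by
  have := isDiscreteValuationRing_of_level_one k haw (DivisorRing k w)
  let K := FractionRing (DivisorRing k w)
  let i := Spec.map (CommRingCat.ofHom (algebraMap (DivisorRing k w) K))
  let κ : Spec (.of K) ⟶ toricVariety k σ :=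
    i ≫ Spec.map (CommRingCat.ofHom (toDivisorRing k hw))
  have hκ : ∀ x, κ x = genericPoint (toricVariety k σ) := by
    intro x
    have h1 : genericPoint (toricVariety k σ) = _ := genericPoint_eq_bot_of_affine
      (CommRingCat.of (AddMonoidAlgebra k (latticeMonoid 1 σ)))
    rw [h1]
    refine PrimeSpectrum.ext ?_
    have hx : x.asIdeal = ⊥ := by
      have := x.isPrime.ne_top
      exact (Ideal.eq_bot_or_top x.asIdeal).resolve_right this
    change Ideal.comap ((algebraMap (DivisorRing k w) K).comp (toDivisorRing k hw)) x.asIdeal = ⊥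
    rw [hx, ← RingHom.ker_eq_comap_bot]
    exact (RingHom.injective_iff_ker_eq_bot _).mp
      ((IsFractionRing.injective _ _).comp (toDivisorRing_injective k hw))
  obtain ⟨η, hη, hηg⟩ := exists_generic_lift hf κ hκ
  obtain ⟨ζ, hζ, hζg⟩ := exists_generic_lift hν η hηg
  -- Only existence of the lift is needed, so universal closedness suffices; integral morphisms such
  -- as a normalization have it too.
  have hex : ValuativeCriterion.Existence (ν ≫ f) :=
    (UniversallyClosed.eq_valuativeCriterion ▸
      (inferInstance : UniversallyClosed (ν ≫ f)) :
      (ValuativeCriterion.Existence ⊓ @QuasiCompact) (ν ≫ f)).1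
  obtain ⟨⟨t, ht₁, ht₂⟩⟩ := (hex
    { R := DivisorRing k w
      K := K
      i₁ := ζ
      i₂ := Spec.map (CommRingCat.ofHom (toDivisorRing k hw))
      commSq := ⟨by rw [← Category.assoc, hζ, hη]⟩ }).exists_lift
  let x₀ : Spec (.of K) := (⟨⊥, Ideal.isPrime_bot⟩ : PrimeSpectrum K)
  refine ⟨t, ht₂, i x₀, ?_, ?_⟩
  · rw [← Scheme.Hom.comp_apply]
    exact (congrArg (fun h : Spec (.of K) ⟶ Z => h x₀) ht₁).trans (hζg x₀)
  · rw [← Scheme.Hom.comp_apply, ← Category.assoc]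
    have h2 : (i ≫ t) ≫ ν = η := by
      rw [← hζ]
      exact congrArg (· ≫ ν) ht₁
    rw [h2, hηg]

/-- If the reduced base change of `F^{(l)}` to `Y` is flat, then any local ring of `Y` dominated by
the local ring of the toric divisor of `w` equals it. -/
theorem stalkClosedPointTo_surjective_of_flat (hw : latticeVec w ∈ σ)
    (ha : latticeVec a ∈ interior (dualCone σ : Set (Fin d → ℝ))) (haw : a ⬝ᵥ w = 1)
    [IsLocalRing (DivisorRing k w)]
    (hl : perpLattice w ≤ AddSubgroup.closure {b | b ∈ perpLattice w ∧
        ∃ x ∈ latticeMonoid l σ, IsMinimalPair σ w b x})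
    {Y : Scheme.{u}} [IsIntegral Y] (f : Y ⟶ toricVariety k σ)
    (hflat : Flat ((pullback f (frobeniusLike k l σ)).nilradical.subschemeι ≫
      pullback.fst f (frobeniusLike k l σ)))
    (t : Spec (CommRingCat.of (DivisorRing k w)) ⟶ Y)
    (ht : t ≫ f = Spec.map (CommRingCat.ofHom (toDivisorRing k hw)))
    (hinj : Function.Injective (Scheme.stalkClosedPointTo t)) :
    Function.Surjective (Scheme.stalkClosedPointTo t) := by
  obtain ⟨_, ⟨U, hU, rfl⟩, hyU, -⟩ := Y.isBasis_affineOpens.exists_subset_of_mem_open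
    (Set.mem_univ (t (IsLocalRing.closedPoint (DivisorRing k w)))) isOpen_univ
  obtain ⟨P, B, i, j, q, hpush, hqflat, hq, hker⟩ := exists_flat_quotient_isPushout
    (CommRingCat.ofHom (inclusionHom k (latticeMonoid_one_le l σ))) f hflat hU
  let ρ := (Scheme.ΓSpecIso (CommRingCat.of (AddMonoidAlgebra k (latticeMonoid 1 σ)))).inv ≫
    f.appLE ⊤ U (le_preimage_top f U)
  let ψ := Scheme.stalkClosedPointTo t
  let φ := Y.presheaf.germ U _ hyU ≫ ψ
  have hρφ : ρ ≫ φ = CommRingCat.ofHom (toDivisorRing k hw) := by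
    exact (Category.assoc _ _ _).trans (appLE_germ_stalkClosedPointTo f t _ ht U hyU)
  have hρφ' : ∀ s, φ.hom (ρ.hom s) = toDivisorRing k hw s := fun s =>
    congrArg (fun h => h.hom s) hρφ
  have hφ : Function.Injective φ.hom := by
    change Function.Injective (ψ.hom ∘ (Y.presheaf.germ U _ hyU).hom)
    exact Function.Injective.comp hinj (germ_injective_of_isIntegral Y _ hyU)
  refine surjective_of_isLocalHom (k := k) (O := DivisorRing k w) hw ha haw ψ.hom
    (fun s => ?_) hl (fun b hb => hb.1)
    fun b ⟨hb, c, hc, hmin⟩ => ?_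
  · exact ⟨_, hρφ' s⟩
  · obtain ⟨r, r', hr, hrr'⟩ := exists_isUnit_mul_rayMonomial (k := k) (O := DivisorRing k w) hw
      ha haw ρ.hom φ.hom hρφ' hφ
      i.hom j.hom (congrArg CommRingCat.Hom.hom hpush.w)
      (by
        algebraize_only [ρ.hom, inclusionHom k (latticeMonoid_one_le l σ), i.hom, j.hom,
          i.hom.comp ρ.hom]
        have h2 : IsScalarTower (AddMonoidAlgebra k (latticeMonoid 1 σ))
          (AddMonoidAlgebra k (latticeMonoid l σ)) P :=
          .of_algebraMap_eq' (congrArg CommRingCat.Hom.hom hpush.w)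
        exact CommRingCat.isPushout_iff_isPushout.mp hpush)
      q.hom hqflat hq hker hb hc hmin
    -- The germ of `r` becomes a unit in `O`, so it is already a unit in the dominated local ring,
    -- and `x^b = r'/r` lies there.
    have hr' : IsUnit (ψ.hom ((Y.presheaf.germ U _ hyU).hom r)) := hr
    obtain ⟨v, hv⟩ := isUnit_of_map_unit ψ.hom _ hr'
    refine ⟨(Y.presheaf.germ U _ hyU).hom r' * (v⁻¹ : _ˣ), ?_⟩
    refine hr'.mul_right_cancel ?_
    rw [map_mul, mul_assoc]
    have h1 : ψ.hom (v⁻¹ : _ˣ) * ψ.hom ((Y.presheaf.germ U _ hyU).hom r) = 1 := by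
      rw [← hv, ← map_mul, Units.inv_mul, map_one]
    rw [h1, mul_one]
    exact hrr'.symm

/-- The toric divisor of `w` appears as a prime divisor on the normalization of `Y`. -/
theorem appearsAsPrimeDivisor_of_flat (hw : latticeVec w ∈ σ)
    (ha : latticeVec a ∈ interior (dualCone σ : Set (Fin d → ℝ))) (haw : a ⬝ᵥ w = 1)
    (hl : perpLattice w ≤ AddSubgroup.closure {b | b ∈ perpLattice w ∧
        ∃ x ∈ latticeMonoid l σ, IsMinimalPair σ w b x})
    {Y Z : Scheme.{u}} (f : Y ⟶ toricVariety k σ) (ν : Z ⟶ Y)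
    (hf : IsBirationalFlattening (frobeniusLike k l σ) f) (hν : IsNormalization ν) :
    AppearsAsPrimeDivisor k hw (ν ≫ f) := by
  have := hf.isIntegral
  have := hf.isProper
  have := hν.isIntegral
  have := hν.isIntegralHom
  have := isDiscreteValuationRing_of_level_one k haw (DivisorRing k w)
  obtain ⟨t, ht, x, hx, hx'⟩ := exists_lift_divisorRing k hw haw f ν hf.birational hν.birational
  have hinj := stalkClosedPointTo_injective t x hx
  -- Flatness is known on `Y`, not on `Z`: the surjection from the local ring of `Y` factors through
  -- that of `Z`.
  have hsurj : Function.Surjective (Scheme.stalkClosedPointTo t) := by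
    have h := stalkClosedPointTo_surjective_of_flat k hw ha haw hl f hf.flat (t ≫ ν)
      (by rw [Category.assoc, ht]) (stalkClosedPointTo_injective (t ≫ ν) x hx')
    rw [Scheme.stalkClosedPointTo_comp] at h
    exact Function.Surjective.of_comp (g := ν.stalkMap _) h
  let z := t (IsLocalRing.closedPoint (DivisorRing k w))
  let ψ : Z.presheaf.stalk z ⟶ .of (DivisorRing k w) := Scheme.stalkClosedPointTo t
  have : IsIso ψ := (ConcreteCategory.isIso_iff_bijective ψ).mpr ⟨hinj, hsurj⟩
  refine ⟨divisorPoint k w, z, isGenericPoint_divisorPoint k w, ?_, (asIso ψ).symm, ?_⟩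
  · have h1 := ringKrullDim_stalk_eq_coheight z
    rw [ringKrullDim_eq_of_ringEquiv (asIso ψ).commRingCatIsoToRingEquiv] at h1
    have h2 : ringKrullDim (DivisorRing k w) = 1 := IsDiscreteValuationRing.ringKrullDim_eq_one _
    have h3 : ((Order.coheight z : ℕ∞) : WithBot ℕ∞) = ((1 : ℕ∞) : WithBot ℕ∞) := h1.symm.trans h2
    exact_mod_cast h3
  · have h1 : Spec.map ψ ≫ Z.fromSpecStalk z = t := Scheme.Spec_stalkClosedPointTo_fromSpecStalk t
    have h2 : Spec.map (asIso ψ).symm.hom ≫ t = Z.fromSpecStalk z := by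
      rw [← h1, ← Category.assoc, ← Spec.map_comp]
      simp
    rw [← h2, Category.assoc, ht]
    exact congrArg (Spec.map (asIso ψ).symm.hom ≫ ·) (fromSpecStalk_divisorPoint k hw)

end Divisor

/-! ### Rays of the fan -/

section Ray

variable {d : ℕ} {σ τ : PointedCone ℝ (Fin d → ℝ)} {w a : Fin d → ℤ}

lemma smul_mem_ray {c : ℝ} (hc : 0 ≤ c) : c • latticeVec w ∈ ray w :=
  Submodule.smul_mem (ray w) (⟨c, hc⟩ : {c : ℝ // 0 ≤ c})
    (Submodule.subset_span (Set.mem_singleton _))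

lemma dotProduct_eq_zero_of_mem_ray {m v : Fin d → ℝ} (hm : m ⬝ᵥ latticeVec w = 0)
    (hv : v ∈ ray w) : m ⬝ᵥ v = 0 := by
  obtain ⟨c, rfl⟩ := Submodule.mem_span_singleton.mp hv
  have : m ⬝ᵥ (c • latticeVec w) = (c : ℝ) * (m ⬝ᵥ latticeVec w) := dotProduct_smul (c : ℝ) _ _
  rw [this, hm, mul_zero]

/-- The vector `e_i - w_i a` lies in `w^⊥ ∩ M` because `a` has level one; pairing it with `v` gives
`v_i = w_i (a, v)`. -/
lemma eq_smul_of_perpLattice (haw : a ⬝ᵥ w = 1) {v : Fin d → ℝ}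
    (h : ∀ b ∈ perpLattice w, latticeVec b ⬝ᵥ v = 0) : v = (latticeVec a ⬝ᵥ v) • latticeVec w := by
  funext i
  have h1 := h (Pi.single i 1 - (w i) • a) (by
    rw [mem_perpLattice, sub_dotProduct, smul_dotProduct, haw]
    simp)
  have h2 : latticeVec (Pi.single i 1 : Fin d → ℤ) ⬝ᵥ v = v i := by
    have : latticeVec (Pi.single i 1 : Fin d → ℤ) = Pi.single i 1 := by
      funext j
      by_cases hj : j = i
      · subst hj; simp [latticeVec]
      · simp [latticeVec, hj]
    rw [this, single_one_dotProduct]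
  rw [latticeVec_sub, latticeVec_zsmul, sub_dotProduct, smul_dotProduct, h2] at h1
  simp only [Pi.smul_apply, smul_eq_mul, latticeVec] at h1 ⊢
  linarith

/-- A finitely generated cone with `w` in its dual-dual, whose supporting lattice functionals
vanishing on `w` generate `w^⊥ ∩ M`, has `ℝ_{≥0} w` as a face. -/
theorem ray_isFaceOf (hrat : IsRationalPolyhedral τ) (haw : a ⬝ᵥ w = 1)
    (ha : ∀ v ∈ τ, v ≠ 0 → 0 < latticeVec a ⬝ᵥ v)
    (hw : ∀ m : Fin d → ℤ, latticeVec m ∈ dualCone τ → 0 ≤ m ⬝ᵥ w)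
    (hperp : ∀ b ∈ perpLattice w, ∃ m ∈ perpLattice w, latticeVec m ∈ dualCone τ ∧
      latticeVec (b + m) ∈ dualCone τ) : (ray w).IsFaceOf τ := by
  classical
  obtain ⟨s, rfl⟩ := hrat
  have hsub : ∀ v ∈ s, latticeVec v ∈ PointedCone.hull ℝ (latticeVec '' (s : Set (Fin d → ℤ))) :=
    fun v hv => Submodule.subset_span ⟨v, hv, rfl⟩
  have hex : ∀ v ∈ s, ∃ m ∈ perpLattice w,
      latticeVec m ∈ dualCone (PointedCone.hull ℝ (latticeVec '' (s : Set (Fin d → ℤ)))) ∧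
      (latticeVec m ⬝ᵥ latticeVec v = 0 → latticeVec v ∈ ray w) := by
    intro v hv
    by_cases h : latticeVec v = (latticeVec a ⬝ᵥ latticeVec v) • latticeVec w
    · refine ⟨0, zero_mem _, by rw [latticeVec_zero]; exact zero_mem _, fun _ => ?_⟩
      rw [h]
      refine smul_mem_ray ?_
      by_cases h0 : latticeVec v = 0
      · rw [h0, dotProduct_zero]
      · exact (ha _ (hsub v hv) h0).le
    · have h' := mt (eq_smul_of_perpLattice haw) h
      push Not at h'
      obtain ⟨b, hb, hbv⟩ := h'
      obtain ⟨m, hm, hm1, hm2⟩ := hperp b hb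
      -- Both `m` and `b + m` are nonnegative on `v`; if their sum vanished there, so would each,
      -- and hence `b`.
      refine ⟨b + m + m, add_mem (add_mem hb hm) hm, ?_, fun h0 => ?_⟩
      · rw [latticeVec_add]
        exact add_mem hm2 hm1
      · have e1 := hm1 _ (hsub v hv)
        have e2 := hm2 _ (hsub v hv)
        rw [latticeVec_add, add_dotProduct] at h0
        have e3 : latticeVec (b + m) ⬝ᵥ latticeVec v = latticeVec b ⬝ᵥ latticeVec v +
          latticeVec m ⬝ᵥ latticeVec v := by rw [latticeVec_add, add_dotProduct]
        exact absurd (by linarith) hbv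
  choose! g hg₁ hg₂ hg₃ using hex
  -- The sum is one functional, nonnegative on `τ` and vanishing on `w`, whose zeros in `τ` all lie
  -- on the ray.
  let m := ∑ v ∈ s, g v
  have hm₁ : m ∈ perpLattice w := sum_mem hg₁
  have hm : ∀ x, latticeVec m ⬝ᵥ x = ∑ v ∈ s, latticeVec (g v) ⬝ᵥ x := fun x => by
    rw [← sum_dotProduct]
    congr 1
    funext i
    simp [m, latticeVec]
  have hmw : latticeVec m ⬝ᵥ latticeVec w = 0 := by
    rw [latticeVec_dotProduct, mem_perpLattice.mp hm₁, Int.cast_zero]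
  have hm₂ : ∀ v ∈ s, 0 ≤ latticeVec m ⬝ᵥ latticeVec v := fun v hv => by
    rw [hm]
    exact Finset.sum_nonneg fun u hu => hg₂ u hu _ (hsub v hv)
  have hm₃ : ∀ v ∈ s, latticeVec m ⬝ᵥ latticeVec v = 0 → latticeVec v ∈ ray w := fun v hv h => by
    rw [hm, Finset.sum_eq_zero_iff_of_nonneg fun u hu => hg₂ u hu _ (hsub v hv)] at h
    exact hg₃ v hv (h v hv)
  have hface : ∀ x ∈ PointedCone.hull ℝ (latticeVec '' (s : Set (Fin d → ℤ))),
      0 ≤ latticeVec m ⬝ᵥ x ∧ (latticeVec m ⬝ᵥ x = 0 → x ∈ ray w) := by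
    intro x hx
    induction hx using Submodule.span_induction with
    | mem x hx =>
      obtain ⟨v, hv, rfl⟩ := hx
      exact ⟨hm₂ v hv, hm₃ v hv⟩
    | zero => exact ⟨by simp, fun _ => zero_mem _⟩
    | add x y _ _ hx hy =>
      rw [dotProduct_add]
      exact ⟨add_nonneg hx.1 hy.1, fun h => add_mem (hx.2 (by linarith [hx.1, hy.1]))
        (hy.2 (by linarith [hx.1, hy.1]))⟩
    | smul c x _ hx =>
      have : latticeVec m ⬝ᵥ (c • x) = (c : ℝ) * (latticeVec m ⬝ᵥ x) :=
        dotProduct_smul (c : ℝ) _ _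
      rw [this]
      refine ⟨mul_nonneg c.2 hx.1, fun h => ?_⟩
      rcases mul_eq_zero.mp h with h | h
      · have : c • x = (c : ℝ) • x := rfl
        rw [this, h, zero_smul]
        exact zero_mem _
      · exact Submodule.smul_mem _ _ (hx.2 h)
  -- If `w ∉ τ`, no nonzero generator lies on the ray, so `m` is positive on all of them. Then `N m
  -- - a` lies in `τ^∨` for large `N` but has level `-1`.
  have hwτ : latticeVec w ∈ PointedCone.hull ℝ (latticeVec '' (s : Set (Fin d → ℤ))) := by
    by_contra hcon
    have hpos : ∀ v ∈ s, latticeVec v ≠ 0 → 0 < latticeVec m ⬝ᵥ latticeVec v := by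
      intro v hv h0
      refine lt_of_le_of_ne (hm₂ v hv) fun h => hcon ?_
      obtain ⟨c, hc⟩ := Submodule.mem_span_singleton.mp (hm₃ v hv h.symm)
      have hc0 : (c : ℝ) ≠ 0 := fun hc0 => h0 (by
        rw [← hc]
        exact (congrArg (· • latticeVec w) hc0).trans (zero_smul ℝ _))
      have : latticeVec w = (c⁻¹ : {c : ℝ // 0 ≤ c}) • latticeVec v := by
        rw [← hc]
        exact (inv_smul_smul₀ hc0 (latticeVec w)).symm
      rw [this]
      exact Submodule.smul_mem _ _ (hsub v hv)
    have hN : ∀ v ∈ s, ∃ N : ℕ, ∀ n : ℕ, N ≤ n →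
        latticeVec a ⬝ᵥ latticeVec v ≤ n * (latticeVec m ⬝ᵥ latticeVec v) := by
      intro v hv
      by_cases h0 : latticeVec v = 0
      · exact ⟨0, fun n _ => by simp [h0]⟩
      · obtain ⟨N, hN⟩ := exists_nat_ge
          (latticeVec a ⬝ᵥ latticeVec v / (latticeVec m ⬝ᵥ latticeVec v))
        refine ⟨N, fun n hn => ?_⟩
        rw [← div_le_iff₀ (hpos v hv h0)]
        exact hN.trans (by exact_mod_cast hn)
    choose! N hN using hN
    have h1 := hw (s.sup N • m - a) (by
      rw [mem_dualCone_hull]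
      rintro _ ⟨v, hv, rfl⟩
      have := hN v hv (s.sup N) (Finset.le_sup hv)
      rw [latticeVec_sub, latticeVec_nsmul, sub_dotProduct, smul_dotProduct, smul_eq_mul]
      linarith)
    rw [sub_dotProduct, smul_dotProduct, mem_perpLattice.mp hm₁, haw] at h1
    simp at h1
  refine ⟨ray_le hwτ, fun {x y c} hx hy hc h => (hface x hx).2 ?_⟩
  have h0 := dotProduct_eq_zero_of_mem_ray hmw h
  rw [dotProduct_add, dotProduct_smul, smul_eq_mul] at h0
  have h1 := (hface x hx).1
  have h2 := (hface y hy).1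
  have h3 : c * (latticeVec m ⬝ᵥ x) = 0 := by
    have := mul_nonneg hc.le h1
    linarith
  exact (mul_eq_zero.mp h3).resolve_left hc.ne'

/-! ### From the local ring on a chart to a face of its cone. -/

variable {k : Type u} [Field k]
  {O : Type*} [CommRing O] [Algebra (AddMonoidAlgebra k (latticeMonoid 1 (ray w))) O]

lemma coeff_toGroupAlgebra {S : AddSubmonoid (Fin d → ℝ)} (f : AddMonoidAlgebra k S) (m : S) :
    (toGroupAlgebra k S f).coeff m.1 = f.coeff m := by
  classical
  induction f using AddMonoidAlgebra.induction_linear with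
  | zero => simp
  | add x y hx hy => simp [hx, hy]
  | single n r =>
    rw [toGroupAlgebra_single, AddMonoidAlgebra.coeff_single, AddMonoidAlgebra.coeff_single,
      Finsupp.single_apply, Finsupp.single_apply]
    simp only [Subtype.ext_iff]

lemma mem_of_coeff_toGroupAlgebra_ne_zero {S : AddSubmonoid (Fin d → ℝ)}
    {f : AddMonoidAlgebra k S} {x : Fin d → ℝ} (h : (toGroupAlgebra k S f).coeff x ≠ 0) :
    x ∈ S := by
  classical
  contrapose! h
  induction f using AddMonoidAlgebra.induction_linear with
  | zero => simp
  | add x y hx hy => simp [hx, hy]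
  | single n r =>
    rw [toGroupAlgebra_single, AddMonoidAlgebra.coeff_single, Finsupp.single_apply, if_neg]
    rintro rfl
    exact h n.2

/-- A homomorphism from `k[τ^∨ ∩ M]` to the local ring of the toric divisor over `k[σ^∨ ∩ M]` is
the identity on monomials. -/
lemma ringHom_fractionRing_apply (hw : latticeVec w ∈ σ)
    (ha : latticeVec a ∈ interior (dualCone σ : Set (Fin d → ℝ))) (hτ : τ ≤ σ)
    (g : AddMonoidAlgebra k (latticeMonoid 1 τ) →+* O)
    (hg : ∀ s, g (inclusionHom k (latticeMonoid_anti 1 hτ) s) =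
      algebraMap (AddMonoidAlgebra k (latticeMonoid 1 (ray w))) O
        (inclusionHom k (latticeMonoid_anti 1 (ray_le hw)) s))
    {i : O →+* FractionRing (AddMonoidAlgebra k (Fin d → ℝ))}
    (hi : ∀ x, i (algebraMap (AddMonoidAlgebra k (latticeMonoid 1 (ray w))) O x) =
      algebraMap _ _ (toGroupAlgebra k _ x)) (f : AddMonoidAlgebra k (latticeMonoid 1 τ)) :
    i (g f) = algebraMap _ _ (toGroupAlgebra k _ f) := by
  have hgi : ∀ s : AddMonoidAlgebra k (latticeMonoid 1 σ),
      i (g (inclusionHom k (latticeMonoid_anti 1 hτ) s)) =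
        algebraMap _ _ (toGroupAlgebra k _ (inclusionHom k (latticeMonoid_anti 1 hτ) s)) := by
    intro s
    rw [hg, hi, toGroupAlgebra_inclusionHom, toGroupAlgebra_inclusionHom]
  induction f using AddMonoidAlgebra.induction_linear with
  | zero => simp
  | add x y hx hy => simp only [map_add, hx, hy]
  | single m r =>
    -- With `Na` and `Na + m` in `σ^∨`, the monomial `x^m` is a fraction of elements of `k[σ^∨ ∩
    -- M]`, where `g` is prescribed.
    obtain ⟨N, hN⟩ := exists_nat_add_smul_mem_interior ha m.1
    obtain ⟨p, hp⟩ := (mem_latticeMonoid_one.mp m.2).2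
    have hNa : latticeVec (N • a) ∈ latticeMonoid 1 σ := by
      rw [latticeVec_mem_latticeMonoid_one, latticeVec_nsmul]
      exact smul_mem_dualCone (interior_subset ha) (Nat.cast_nonneg N)
    have hNm : latticeVec (N • a) + m.1 ∈ latticeMonoid 1 σ := by
      refine mem_latticeMonoid_one.mpr ⟨?_, N • a + p, by rw [latticeVec_add, hp]⟩
      rw [latticeVec_nsmul, add_comm]
      exact interior_subset (hN N le_rfl)
    have h1 := hgi (.single ⟨_, hNa⟩ 1)
    have h2 := hgi (.single ⟨_, hNm⟩ r)
    have h3 : inclusionHom k (latticeMonoid_anti 1 hτ) (.single ⟨_, hNm⟩ r) =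
        inclusionHom k (latticeMonoid_anti 1 hτ) (.single ⟨_, hNa⟩ 1) * .single m r := by
      rw [inclusionHom_single, inclusionHom_single, AddMonoidAlgebra.single_mul_single, one_mul]
      rfl
    rw [h3, map_mul, map_mul, h1, map_mul, map_mul] at h2
    refine mul_left_cancel₀ ?_ h2
    rw [inclusionHom_single, toGroupAlgebra_single, Ne,
      map_eq_zero_iff _ (IsFractionRing.injective _ _)]
    simp

variable [IsLocalization.AtPrime O (divisorIdeal k w)]

lemma ringHom_fractionRing_injective {i : O →+* FractionRing (AddMonoidAlgebra k (Fin d → ℝ))}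
    (hi : ∀ x, i (algebraMap (AddMonoidAlgebra k (latticeMonoid 1 (ray w))) O x) =
      algebraMap _ _ (toGroupAlgebra k _ x)) : Function.Injective i := by
  refine (injective_iff_map_eq_zero i).mpr fun z hz => ?_
  obtain ⟨⟨f, s⟩, hfs⟩ := IsLocalization.surj (divisorIdeal k w).primeCompl z
  have h1 := congrArg i hfs
  rw [map_mul, hz, zero_mul, hi, eq_comm, map_eq_zero_iff _ (IsFractionRing.injective _ _),
    map_eq_zero_iff _ (toGroupAlgebra_injective k _)] at h1
  have h2 : f = 0 := h1
  subst h2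
  rw [map_zero] at hfs
  exact (IsLocalization.map_units O s).mul_left_eq_zero.mp hfs

/-- If `m` had negative level, `x^(-m)` would lie in the divisor ideal and yet have the inverse
`g(x^m)` in `O`. -/
lemma nonneg_of_latticeVec_mem_dualCone (hw : latticeVec w ∈ σ)
    (ha : latticeVec a ∈ interior (dualCone σ : Set (Fin d → ℝ))) (hτ : τ ≤ σ)
    (g : AddMonoidAlgebra k (latticeMonoid 1 τ) →+* O)
    (hg : ∀ s, g (inclusionHom k (latticeMonoid_anti 1 hτ) s) =
      algebraMap (AddMonoidAlgebra k (latticeMonoid 1 (ray w))) O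
        (inclusionHom k (latticeMonoid_anti 1 (ray_le hw)) s))
    {m : Fin d → ℤ} (hm : latticeVec m ∈ dualCone τ) : 0 ≤ m ⬝ᵥ w := by
  obtain ⟨i, hi⟩ := exists_ringHom_fractionRing k w O
  have key := ringHom_fractionRing_apply hw ha hτ g hg hi
  by_contra! hneg
  have hn : 0 ≤ (-m) ⬝ᵥ w := by rw [neg_dotProduct]; omega
  have h1 : algebraMap _ O (rayMonomial k (-m) hn) *
      g (.single ⟨_, latticeVec_mem_latticeMonoid_one.mpr hm⟩ 1) = 1 := by
    refine ringHom_fractionRing_injective hi ?_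
    have h0 : latticeVec (-m) + latticeVec m = 0 := by rw [latticeVec_neg, neg_add_cancel]
    rw [map_mul, hi, key, map_one, rayMonomial, toGroupAlgebra_single, toGroupAlgebra_single,
      ← map_mul, AddMonoidAlgebra.single_mul_single, mul_one, h0, ← AddMonoidAlgebra.one_def,
      map_one]
  have h2 := (IsLocalization.AtPrime.isUnit_to_map_iff O (divisorIdeal k w)
    (rayMonomial k (-m) hn)).mp (IsUnit.of_mul_eq_one _ h1)
  refine h2 ?_
  change faceHom k w _ = 0
  rw [rayMonomial, faceHom_single, if_neg]
  rw [latticeVec_dotProduct, neg_dotProduct]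
  exact_mod_cast (by omega : -(m ⬝ᵥ w) ≠ 0)

/-- If the local ring of the toric divisor is a ring of fractions of `k[τ^∨ ∩ M]`, then
`ℝ_{≥0} w` is a face of `τ`. -/
theorem ray_isFaceOf_of_localization (hrat : IsRationalPolyhedral τ)
    (hw : latticeVec w ∈ σ)
    (ha : latticeVec a ∈ interior (dualCone σ : Set (Fin d → ℝ))) (haw : a ⬝ᵥ w = 1) (hτ : τ ≤ σ)
    (g : AddMonoidAlgebra k (latticeMonoid 1 τ) →+* O)
    (hg : ∀ s, g (inclusionHom k (latticeMonoid_anti 1 hτ) s) =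
      algebraMap (AddMonoidAlgebra k (latticeMonoid 1 (ray w))) O
        (inclusionHom k (latticeMonoid_anti 1 (ray_le hw)) s))
    (hfrac : ∀ y : O, ∃ f s, IsUnit (g s) ∧ y * g s = g f) : (ray w).IsFaceOf τ := by
  have hnonneg : ∀ m : Fin d → ℤ, latticeVec m ∈ dualCone τ → 0 ≤ m ⬝ᵥ w := fun m hm =>
    nonneg_of_latticeVec_mem_dualCone hw ha hτ g hg hm
  refine ray_isFaceOf hrat haw (fun v hv h0 => dotProduct_pos_of_mem_interior ha (hτ hv) h0)
    hnonneg fun b hb => ?_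
  obtain ⟨i, hi⟩ := exists_ringHom_fractionRing k w O
  have key := ringHom_fractionRing_apply hw ha hτ g hg hi
  have hle : latticeMonoid 1 τ ≤ latticeMonoid 1 (ray w) := by
    intro x hx
    obtain ⟨m, rfl⟩ := (mem_latticeMonoid_one.mp hx).2
    exact latticeVec_mem_latticeMonoid_ray.mpr (hnonneg m hx.1)
  have hgle : ∀ f, g f = algebraMap _ O (inclusionHom k hle f) := fun f =>
    ringHom_fractionRing_injective hi (by
    rw [key, hi, toGroupAlgebra_inclusionHom])
  obtain ⟨f, s, hs, hfs⟩ := hfrac (algebraMap _ O (rayMonomial k b (nonneg_of_mem_perpLattice hb)))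
  rw [hgle, IsLocalization.AtPrime.isUnit_to_map_iff O (divisorIdeal k w)] at hs
  rw [hgle, hgle, ← map_mul, (algebraMap_localization_injective k w O).eq_iff] at hfs
  -- A denominator `s` outside the divisor ideal has an exponent `m` of level zero. Comparing
  -- coefficients in `x^b s = f` puts `b + m` among the exponents of `f`, so in `τ^∨`.
  obtain ⟨m, hm, hmw⟩ : ∃ m, s.coeff m ≠ 0 ∧ m.1 ⬝ᵥ latticeVec w = 0 := by
    by_contra! h
    refine hs ?_
    change faceHom k w _ = 0
    rw [← AddMonoidAlgebra.sum_coeff_single s, map_finsuppSum, map_finsuppSum]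
    refine Finset.sum_eq_zero fun m hm => ?_
    change faceHom k w (inclusionHom k hle _) = 0
    rw [inclusionHom_single, faceHom_single, if_neg (h m (Finsupp.mem_support_iff.mp hm))]
  obtain ⟨p, hp⟩ := (mem_latticeMonoid_one.mp m.2).2
  refine ⟨p, ?_, hp ▸ m.2.1, ?_⟩
  · rw [hp, latticeVec_dotProduct] at hmw
    exact_mod_cast hmw
  · rw [latticeVec_add, ← hp]
    have h1 := congrArg (fun z => (toGroupAlgebra k _ z).coeff (latticeVec b + m.1)) hfs
    simp only [map_mul, toGroupAlgebra_inclusionHom, rayMonomial, toGroupAlgebra_single] at h1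
    rw [AddMonoidAlgebra.coeff_single_mul_apply, neg_add_cancel_left, one_mul,
      coeff_toGroupAlgebra] at h1
    have h2 : latticeVec b + m.1 ∈ latticeMonoid 1 τ :=
      mem_of_coeff_toGroupAlgebra_ne_zero (h1 ▸ hm)
    exact h2.1

/-- If the toric divisor of `w` appears as a prime divisor on the toric variety of `Δ`, then
`ℝ_{≥0} w` is a cone of `Δ`. -/
theorem ray_mem_of_isFanOf (hw : latticeVec w ∈ σ)
    (ha : latticeVec a ∈ interior (dualCone σ : Set (Fin d → ℝ))) (haw : a ⬝ᵥ w = 1)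
    {Z : Scheme.{u}} {π : Z ⟶ toricVariety k σ} (h : AppearsAsPrimeDivisor k hw π)
    {Δ : Fan d} (hΔ : Δ.IsFanOf k π) : ray w ∈ Δ.cones := by
  obtain ⟨e, z, he, -, φ, hφ⟩ := h
  obtain rfl : e = divisorPoint k w := he.eq (isGenericPoint_divisorPoint k w)
  obtain ⟨hle, j, hj, hjπ, -, -, hcov⟩ := hΔ
  obtain ⟨τ, t, rfl⟩ := hcov z
  have := hj τ
  refine Δ.face_mem τ.1 τ.2 _ ?_
  -- The chart is open in `Z`, so `O` is identified with a localization of `k[τ^∨ ∩ M]` at a prime.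
  let χ : (toricVariety k (ray w)).presheaf.stalk (divisorPoint k w) ≅
    (toricVariety k τ.1).presheaf.stalk t := φ ≪≫ asIso ((j τ).stalkMap t)
  have h1 : Spec.map χ.hom ≫ Spec.map (CommRingCat.ofHom (toDivisorRing k hw)) =
      (toricVariety k τ.1).fromSpecStalk t ≫ toricMap k (hle τ.1 τ.2) := by
    have h0 := Scheme.SpecMap_stalkMap_fromSpecStalk (j τ) (x := t)
    rw [← hjπ τ, ← Category.assoc _ (j τ), ← h0, Category.assoc, ← hφ, Iso.trans_hom,
      Spec.map_comp, Category.assoc]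
    exact congrArg (Spec.map ((j τ).stalkMap t) ≫ Spec.map φ.hom ≫ ·)
      (fromSpecStalk_divisorPoint k hw).symm
  let : Algebra (AddMonoidAlgebra k (latticeMonoid 1 τ.1))
      ((toricVariety k τ.1).presheaf.stalk t) :=
    StructureSheaf.stalkAlgebra (AddMonoidAlgebra k (latticeMonoid 1 τ.1)) t
  have h2 : (toricVariety k τ.1).fromSpecStalk t ≫ toricMap k (hle τ.1 τ.2) =
      Spec.map (CommRingCat.ofHom ((algebraMap (AddMonoidAlgebra k (latticeMonoid 1 τ.1))
        ((toricVariety k τ.1).presheaf.stalk t)).comp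
        (inclusionHom k (latticeMonoid_anti 1 (hle τ.1 τ.2))))) :=
    (congrArg (· ≫ toricMap k (hle τ.1 τ.2)) (Spec.fromSpecStalk_eq' _ _)).trans
      (Spec.map_comp _ _).symm
  have h3 : CommRingCat.ofHom (toDivisorRing k hw) ≫ χ.hom = _ :=
    Spec.map_injective ((Spec.map_comp _ _).trans (h1.trans h2))
  let P : PrimeSpectrum (AddMonoidAlgebra k (latticeMonoid 1 τ.1)) := t
  have : IsLocalization.AtPrime ((toricVariety k τ.1).presheaf.stalk t) P.asIdeal :=
    StructureSheaf.IsLocalization.to_stalk _ P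
  have hinv : ∀ x, χ.inv.hom (χ.hom.hom x) = x := fun x =>
    congrArg (fun h => h.hom x) χ.hom_inv_id
  have := isDiscreteValuationRing_of_level_one k haw (DivisorRing k w)
  refine ray_isFaceOf_of_localization (k := k) (O := DivisorRing k w) (Δ.rational τ.1 τ.2) hw ha haw
    (hle τ.1 τ.2) (χ.inv.hom.comp (algebraMap _ _)) (fun s => ?_) fun y => ?_
  · exact (congrArg (fun h => χ.inv.hom (h.hom s)) h3).symm.trans (hinv _)
  · obtain ⟨⟨f, s⟩, hfs⟩ := IsLocalization.surj P.asIdeal.primeCompl (χ.hom.hom y)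
    refine ⟨f, s, (IsLocalization.map_units _ s).map χ.inv.hom, ?_⟩
    let ψ : (toricVariety k τ.1).presheaf.stalk t →+* DivisorRing k w := χ.inv.hom
    have h4 : ψ (χ.hom.hom y) * ψ _ = ψ _ := (map_mul ψ _ _).symm.trans (congrArg ψ hfs)
    have h5 : ψ (χ.hom.hom y) = y := hinv y
    rw [h5] at h4
    exact h4

end Ray

/-! ### Interior points of the level-one polyhedron -/

section Level

variable {d : ℕ} {σ : PointedCone ℝ (Fin d → ℝ)} {w : Fin d → ℤ}

/-- The dual of a strongly convex polyhedral cone has nonempty interior. -/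
theorem interior_dualCone_nonempty (hrat : IsRationalPolyhedral σ)
    (hsal : (σ : ConvexCone ℝ (Fin d → ℝ)).Salient) :
    (interior (dualCone σ : Set (Fin d → ℝ))).Nonempty := by
  classical
  obtain ⟨s, rfl⟩ := hrat
  set σ := PointedCone.hull ℝ (latticeVec '' (s : Set (Fin d → ℤ))) with hσ
  -- By salience the nonzero vectors of `σ` form a convex set, so `0` is not in the convex hull of
  -- the nonzero generators. Separation gives a functional positive on all of them, which is an open
  -- condition inside `σ^∨`.
  have hconv : Convex ℝ {x : Fin d → ℝ | x ∈ σ ∧ x ≠ 0} := by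
    rintro x ⟨hx, hx0⟩ y ⟨hy, hy0⟩ b c hb hc hbc
    have h1 : b • x ∈ σ := Submodule.smul_mem σ (⟨b, hb⟩ : {c : ℝ // 0 ≤ c}) hx
    have h2 : c • y ∈ σ := Submodule.smul_mem σ (⟨c, hc⟩ : {c : ℝ // 0 ≤ c}) hy
    refine ⟨add_mem h1 h2, fun h => ?_⟩
    rcases eq_or_ne b 0 with rfl | hb0
    · rw [zero_add] at hbc
      subst hbc
      exact hy0 (by simpa using h)
    · refine hsal _ h1 (smul_ne_zero hb0 hx0) ?_
      rw [neg_eq_of_add_eq_zero_right h]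
      exact h2
  let V : Set (Fin d → ℝ) := latticeVec '' (s : Set (Fin d → ℤ)) \ {0}
  have hV : V.Finite := (s.finite_toSet.image _).sdiff
  have h0 : (0 : Fin d → ℝ) ∉ convexHull ℝ V := fun h =>
    (convexHull_min (t := {x : Fin d → ℝ | x ∈ σ ∧ x ≠ 0})
      (fun v hv => ⟨Submodule.subset_span hv.1, hv.2⟩) hconv h).2 rfl
  obtain ⟨f, u, hf0, hf⟩ := geometric_hahn_banach_point_closed (convex_convexHull ℝ V)
    (hV.isCompact_convexHull (𝕜 := ℝ)).isClosed h0
  rw [map_zero] at hf0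
  have hfq : ∀ v, f v = (fun i => f (Pi.single i 1)) ⬝ᵥ v := fun v => by
    have := LinearMap.pi_apply_eq_sum_univ f.toLinearMap v
    simp only [smul_eq_mul, ContinuousLinearMap.coe_coe] at this
    rw [this, dotProduct]
    refine Finset.sum_congr rfl fun i _ => ?_
    rw [mul_comm]
    congr 2
    funext j
    simp [Pi.single_apply, eq_comm]
  have hopen : IsOpen (⋂ v ∈ V, {x : Fin d → ℝ | 0 < x ⬝ᵥ v}) :=
    hV.isOpen_biInter fun v _ => isOpen_lt continuous_const (by fun_prop)
  refine ⟨_, interior_maximal (fun x hx => ?_) hopen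
    (Set.mem_iInter₂.mpr fun v hv => ?_ : (fun i => f (Pi.single i 1)) ∈ _)⟩
  · refine mem_dualCone_hull.mpr fun v hv => ?_
    by_cases hv0 : v = 0
    · simp [hv0]
    · exact (Set.mem_iInter₂.mp hx v ⟨hv, hv0⟩).le
  · change 0 < _ ⬝ᵥ v
    rw [← hfq]
    exact hf0.trans (hf v (subset_convexHull ℝ V hv))

lemma dotProduct_eq_of_mem_affineSpan {c : ℝ} {x : Fin d → ℝ}
    (hx : x ∈ affineSpan ℝ (levelPolyhedron σ w c)) : x ⬝ᵥ latticeVec w = c := by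
  refine affineSpan_induction hx (fun x hx => hx.2) fun r p q s hp hq hs => ?_
  simp [add_dotProduct, smul_dotProduct, sub_dotProduct, hp, hq, hs]

/-- The interior points of `σ^∨` of level one are the relatively interior points of the level-one
polyhedron. -/
theorem mem_intrinsicInterior_levelPolyhedron_iff
    (hne : (interior (dualCone σ : Set (Fin d → ℝ))).Nonempty) (hw : latticeVec w ∈ σ)
    (hw0 : w ≠ 0) {a : Fin d → ℤ} :
    latticeVec a ∈ intrinsicInterior ℝ (levelPolyhedron σ w 1) ↔
      latticeVec a ∈ interior (dualCone σ : Set (Fin d → ℝ)) ∧ a ⬝ᵥ w = 1 := by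
  have hlev : latticeVec a ⬝ᵥ latticeVec w = 1 ↔ a ⬝ᵥ w = 1 := by
    rw [latticeVec_dotProduct]
    exact_mod_cast Iff.rfl
  constructor
  · intro h
    have hmem := intrinsicInterior_subset h
    refine ⟨?_, hlev.mp hmem.2⟩
    obtain ⟨y, hy, hya⟩ := mem_intrinsicInterior.mp h
    obtain ⟨q₀, hq₀⟩ := hne
    have hpos : 0 < q₀ ⬝ᵥ latticeVec w := dotProduct_pos_of_mem_interior hq₀ hw
      (fun h => hw0 (latticeVec_injective (by simpa using h)))
    -- An interior point of `σ^∨` rescaled to level one. Prolonging the segment from `q` to `a`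
    -- slightly past `a` stays in the polyhedron, which makes `a` a proper convex combination
    -- involving the interior point `q`.
    let q := (q₀ ⬝ᵥ latticeVec w)⁻¹ • q₀
    have hq : q ∈ interior (dualCone σ : Set (Fin d → ℝ)) :=
      smul_mem_interior_dualCone hq₀ (inv_pos.mpr hpos)
    have hqmem : q ∈ levelPolyhedron σ w 1 :=
      ⟨interior_subset hq, by rw [smul_dotProduct, smul_eq_mul, inv_mul_cancel₀ hpos.ne']⟩
    have hline : ∀ t : ℝ, AffineMap.lineMap (latticeVec a) q t ∈
        affineSpan ℝ (levelPolyhedron σ w 1) := fun t =>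
      AffineMap.lineMap_mem _ (subset_affineSpan ℝ _ hmem) (subset_affineSpan ℝ _ hqmem)
    let g : ℝ → affineSpan ℝ (levelPolyhedron σ w 1) := fun t => ⟨_, hline (-t)⟩
    have hg : Continuous g := Continuous.subtype_mk
      (AffineMap.lineMap_continuous.comp continuous_neg) _
    have hg0 : g 0 = y := Subtype.ext (by simp [g, hya])
    have hev : ∀ᶠ t in nhds (0 : ℝ), (g t).1 ∈ levelPolyhedron σ w 1 :=
      hg.continuousAt (hg0 ▸ mem_interior_iff_mem_nhds.mp hy)
    obtain ⟨ε, hε, hball⟩ := Metric.eventually_nhds_iff.mp hev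
    have h1 := hball (y := ε / 2) (by
      rw [Real.dist_eq, sub_zero, abs_of_pos (half_pos hε)]
      exact half_lt_self hε)
    have h2 := smul_mem_interior_dualCone (add_mem_interior_dualCone h1.1
      (smul_mem_interior_dualCone hq (half_pos hε))) (inv_pos.mpr (by positivity : 0 < 1 + ε / 2))
    convert h2 using 1
    rw [eq_inv_smul_iff₀ (by positivity)]
    simp only [g, AffineMap.lineMap_apply, vsub_eq_sub, vadd_eq_add]
    module
  · rintro ⟨ha, haw⟩
    refine mem_intrinsicInterior.mpr
      ⟨⟨_, subset_affineSpan ℝ _ ⟨interior_subset ha, hlev.mpr haw⟩⟩, ?_, rfl⟩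
    -- The affine span lies in the hyperplane of level one, so its intersection with the interior of
    -- `σ^∨` is a relatively open part of the polyhedron.
    refine interior_maximal (t := Subtype.val ⁻¹' interior (dualCone σ : Set (Fin d → ℝ)))
      (fun y hy => ?_) (isOpen_interior.preimage continuous_subtype_val) ha
    exact ⟨interior_subset hy, dotProduct_eq_of_mem_affineSpan y.2⟩

/-- One bound on `l` serves all `w` of level one at an interior lattice point. -/
theorem exists_forall_level_one (hrat : IsRationalPolyhedral σ) :
    ∃ l₀ : ℕ+, ∀ l : ℕ+, l₀ ≤ l → ∀ w : Fin d → ℤ, latticeVec w ∈ σ →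
      (∃ a : Fin d → ℤ, latticeVec a ∈ interior (dualCone σ : Set (Fin d → ℝ)) ∧ a ⬝ᵥ w = 1) →
      perpLattice w ≤ AddSubgroup.closure {b | b ∈ perpLattice w ∧
        ∃ x ∈ latticeMonoid l σ, IsMinimalPair σ w b x} := by
  have hfin := finite_setOf_level_one hrat
  have hex : ∀ w ∈ hfin.toFinset, ∃ l₀ : ℕ, ∀ l : ℕ+, l₀ ≤ l →
      perpLattice w ≤ AddSubgroup.closure {b | b ∈ perpLattice w ∧
        ∃ x ∈ latticeMonoid l σ, IsMinimalPair σ w b x} := by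
    intro w hw
    obtain ⟨hw, a, ha, haw⟩ := hfin.mem_toFinset.mp hw
    exact exists_forall_perpLattice_le_closure haw hw ha
  choose! f hf using hex
  -- The `+ 1` only makes the bound positive.
  refine ⟨⟨hfin.toFinset.sup f + 1, by omega⟩, fun l hl w hw h => ?_⟩
  have hmem := hfin.mem_toFinset.mpr ⟨hw, h⟩
  refine hf w hmem l ((Finset.le_sup hmem).trans ?_)
  have : hfin.toFinset.sup f + 1 ≤ (l : ℕ) := hl
  omega

end Level

end FBlowup

end

theorem mainTheorem1 (k : Type u) [Field k] {d : ℕ} (σ : PointedCone ℝ (Fin d → ℝ))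
    (hrat : FBlowup.IsRationalPolyhedral σ)
    (hsal : (σ : ConvexCone ℝ (Fin d → ℝ)).Salient)
    (hdim : Submodule.span ℝ (σ : Set (Fin d → ℝ)) = ⊤) :
    (∀ w : Fin d → ℤ, FBlowup.latticeVec w ∈ σ → FBlowup.IsPrimitive w →
      ((∃ a : Fin d → ℤ,
          FBlowup.latticeVec a ∈ interior (FBlowup.dualCone σ : Set (Fin d → ℝ)) ∧ a ⬝ᵥ w = 1) ↔
        ∃ a : Fin d → ℤ,
          FBlowup.latticeVec a ∈ intrinsicInterior ℝ (FBlowup.levelPolyhedron σ w 1))) ∧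
    ∃ l₀ : ℕ+, ∀ l : ℕ+, l₀ ≤ l →
      ∀ (Y Z : Scheme.{u}) (f : Y ⟶ FBlowup.toricVariety k σ) (ν : Z ⟶ Y),
        FBlowup.IsFBlowup k σ l f → FBlowup.IsNormalization ν →
        ∀ (w : Fin d → ℤ) (hw : FBlowup.latticeVec w ∈ σ), FBlowup.IsPrimitive w →
          (∃ a : Fin d → ℤ,
            FBlowup.latticeVec a ∈ interior (FBlowup.dualCone σ : Set (Fin d → ℝ)) ∧
              a ⬝ᵥ w = 1) →
          (∀ Δ : FBlowup.Fan d, Δ.IsFanOf k (ν ≫ f) → FBlowup.ray w ∈ Δ.cones) ∧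
          FBlowup.AppearsAsPrimeDivisor k hw (ν ≫ f) := by
  refine ⟨fun w hw hprim => exists_congr fun a =>
    (FBlowup.mem_intrinsicInterior_levelPolyhedron_iff
      (FBlowup.interior_dualCone_nonempty hrat hsal) hw hprim.1).symm, ?_⟩
  -- The bound comes from the geometry of the cone alone, before `w`, `Y` and `Z` are chosen.
  obtain ⟨l₀, hl₀⟩ := FBlowup.exists_forall_level_one hrat
  refine ⟨l₀, fun l hl Y Z f ν hf hν w hw _ hex => ?_⟩
  have hl' := hl₀ l hl w hw hex
  obtain ⟨a, ha, haw⟩ := hex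
  have happ := FBlowup.appearsAsPrimeDivisor_of_flat k hw ha haw hl' f ν hf.isFlattening hν
  exact ⟨fun Δ hΔ => FBlowup.ray_mem_of_isFanOf hw ha haw happ hΔ, happ⟩
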